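/- Let $\mathcal V$ be a complex superspace with $N$ even and $M$ odd coordinates, $[a]\in\mathbb Z/2$ the degree of the index $a$, and let $\epsilon=\pm1$. Let $\varepsilon_{ab}\in\mathbb C$ be an invertible even super-metric: $\varepsilon_{ab}=0$ if $[a]\ne[b]$, and $\varepsilon_{ab}=\epsilon(-1)^{[a][b]}\varepsilon_{ba}$. Let $\varepsilon^{ab}$ be the inverse matrix and $\omega=\epsilon(N-M)$. Repeated indices are summed. Let $\mathcal A$ be the associative unital $\mathbb C$-algebra generated by the super-oscillators $c^a$ (of degree $[a]$) with $c^ac^b+\epsilon(-1)^{[a][b]}c^bc^a=\varepsilon^{ab}$. Let $c^{(a_1}\cdots c^{a_k)}=\frac1{k!}\sum_{\sigma\in S_k}s_\sigma\,c^{a_{\sigma(1)}}\cdots c^{a_{\sigma(k)}}$, where $s_\sigma$ is the product of $-\epsilon(-1)^{[a_{\sigma(i)}][a_{\sigma(j)}]}$ over all $i<j$ with $\sigma(i)>\sigma(j)$, and put $F^{ab}=\epsilon(-1)^{[b]}c^{(a}c^{b)}$. Let $\mathcal H$ be the algebra generated by $x_a,\partial_a$ (of degree $[a]$) with $$x_ax_b=\epsilon(-1)^{[a][b]}x_bx_a,\quad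 \partial_a\partial_b=\epsilon(-1)^{[a][b]}\partial_b\partial_a,\quad \partial_ax_b-\epsilon(-1)^{[a][b]}x_b\partial_a=\varepsilon_{ab},$$ and let $M_{ab}=x_a\partial_b-\epsilon(-1)^{[a][b]+[a]+[b]}x_b\partial_a\in\mathcal H$, of degree $[a]+[b]$ (the Jordan–Schwinger generators of $osp$). **(i)** For all indices $a,b,c,d$ one has $\{M_{(bc},M_{d)a}\}_\mp=0$. Here $\{X,Y\}_\mp=XY+(-1)^{[X][Y]}YX$, and $(bcd)$ denotes the supersymmetrization over $b,c,d$ as above, but with the factor $-\epsilon(-1)^{[s][t]+[s]+[t]}$ for the exchange of the indices $s,t$. **(ii)** In the graded tensor product $\mathcal A\otimes\mathcal A\otimes\mathcal H$ let $c_1^a,c_2^a$ denote the generators of the first and second factor, let $F_1^{ab},F_2^{ab}$ be the corresponding copies of $F^{ab}$, and let $L_j(u)=u\,I-\frac12F_j^{ab}M_{ba}$ for $j=1,2$, where $I$ is the unit element. Consider the formal series $$\check{\mathcal R}_{12}(u)=\sum_{k\ge0}\frac{r_k(u)}{k!}\,\varepsilon_{a_1b_1}\cdots\varepsilon_{a_kb_k}\,c_1^{(a_1}\cdots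 c_1^{a_k)}\,c_2^{(b_k}\cdots c_2^{b_1)} .$$ Then for all $u,v\in\mathbb C$ $$\check{\mathcal R}_{12}(u)L_1(u+v)L_2(v)=L_1(v)L_2(u+v)\check{\mathcal R}_{12}(u)$$ whenever the numbers $r_k(u)$ satisfy $(k+2+u-\omega)\,r_{k+2}(u)=4(u-k)\,r_k(u)$ for all $k\ge0$. In particular, this relation holds for all $u\in\mathbb C\setminus\{0,1,2,\dots\}$, all $v\in\mathbb C$ and arbitrary functions $A,B:\mathbb C\to\mathbb C$, if for all $m\ge0$ $$r_{2m}(u)=(-4)^m\frac{\Gamma(m-\frac u2)}{\Gamma(m+1+\frac{u-\omega}2)}A(u),\qquad r_{2m+1}(u)=(-4)^m\frac{\Gamma(m-\frac{u-1}2)}{\Gamma(m+1+\frac{u-\omega+1}2)}B(u),$$ where $1/\Gamma$ is zero at the poles of $\Gamma$. The products with the formal series are taken termwise, and the equality means equality of all coefficients with respect to the supersymmetrized monomials in $c_1$ and in $c_2$: for every $n$, the difference of the two sides for the $K$-th partial sum lies, for all large $K$, in the span of the elements $c_1^{(a_1}\cdots c_1^{a_k)}c_2^{(b_1}\cdots c_2^{b_l)}h$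 with $k+l\ge n$ and $h\in\mathcal H$. -/

import Mathlib

noncomputable section

/-- The sign `(-1)^x` of a degree `x ∈ ℤ/2`. -/
def sgn (x : ZMod 2) : ℂ := if x = 0 then 1 else -1

/-- A superspace with coordinates indexed by `ι`, the coordinate `a` having degree `deg a`,
endowed with an even non-degenerate super-metric `ε_{ab} = g a b` of symmetry type
`ϵ = eps = ± 1`. -/
structure SuperMetric (ι : Type*) [Fintype ι] [DecidableEq ι] where
  deg : ι → ZMod 2
  eps : ℂ
  g : Matrix ι ι ℂ
  eps_eq : eps = 1 ∨ eps = -1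
  symm : ∀ a b, g a b = eps * sgn (deg a * deg b) * g b a
  even : ∀ a b, g a b ≠ 0 → deg a + deg b = 0
  nondeg : IsUnit g.det

/-- The sign acquired by a word `a_0 … a_{k-1}` when it is rearranged to
`a_{σ 0} … a_{σ (k-1)}`, if the exchange of two adjacent letters `s, t` costs the factor `w s t`:
the product of the factors of all inverted pairs. -/
def wordSign {ι : Type*} (w : ι → ι → ℂ) {k : ℕ} (σ : Equiv.Perm (Fin k)) (a : Fin k → ι) : ℂ :=
  ∏ i : Fin k, ∏ j : Fin k, if i < j ∧ σ j < σ i then w (a (σ i)) (a (σ j)) else 1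

/-- Super-symmetrization of a function of `k` indices with exchange factors `w`. -/
def superSym {ι : Type*} (w : ι → ι → ℂ) {V : Type*} [AddCommGroup V] [Module ℂ V] {k : ℕ}
    (f : (Fin k → ι) → V) (a : Fin k → ι) : V :=
  ((k.factorial : ℂ)⁻¹) • ∑ σ : Equiv.Perm (Fin k), wordSign w σ a • f (fun i => a (σ i))

/-- The super-anticommutator `XY + (-1)^{xy} YX` of elements `X`, `Y` of degrees `x`, `y`. -/
def superAnti {B : Type*} [Ring B] [Algebra ℂ B] (x y : ZMod 2) (X Y : B) : B :=
  X * Y + sgn (x * y) • (Y * X)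

namespace SuperMetric

variable {ι : Type*} [Fintype ι] [DecidableEq ι] (S : SuperMetric ι)

/-- `ω = ϵ (N - M)`, with `N` even and `M` odd coordinates. -/
def omega : ℂ :=
  S.eps * (((Finset.univ.filter fun a => S.deg a = 0).card : ℂ)
    - ((Finset.univ.filter fun a => S.deg a = 1).card : ℂ))

/-- The sign `ϵ (-1)^{[a][b]}`. -/
def exch (a b : ι) : ℂ := S.eps * sgn (S.deg a * S.deg b)

/-! ### The super-oscillator algebra -/

/-- `c^a c^b + ϵ (-1)^{[a][b]} c^b c^a = ε^{ab}`, where `ε^{ab}` is the matrix inverse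
to `ε_{ab}`. -/
inductive OscRel : FreeAlgebra ℂ ι → FreeAlgebra ℂ ι → Prop
  | rel (a b : ι) : OscRel
      (FreeAlgebra.ι ℂ a * FreeAlgebra.ι ℂ b
        + S.exch a b • (FreeAlgebra.ι ℂ b * FreeAlgebra.ι ℂ a))
      (algebraMap ℂ (FreeAlgebra ℂ ι) (S.g⁻¹ a b))

/-- The algebra `𝒜` of super-oscillators. -/
abbrev Osc := RingQuot S.OscRel

/-- The super-oscillator `c^a`, of degree `[a]`. -/
def c (a : ι) : S.Osc := RingQuot.mkAlgHom ℂ S.OscRel (FreeAlgebra.ι ℂ a)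

/-- The super-symmetrized product `c^{(a_1} ⋯ c^{a_k)}`, whose elementary transpositions
carry the factors `-ϵ (-1)^{[a][b]}`. -/
def symProd {k : ℕ} (a : Fin k → ι) : S.Osc :=
  superSym (fun s t => -S.exch s t) (fun b : Fin k → ι => (List.ofFn fun i => S.c (b i)).prod) a

/-- `F^{ab} = ϵ (-1)^{[b]} c^{(a} c^{b)}`. -/
def F (a b : ι) : S.Osc := (S.eps * sgn (S.deg b)) • S.symProd ![a, b]

/-! ### The graded Heisenberg algebra and the Jordan-Schwinger generators -/

/-- Relations of the graded canonical pairs; `Sum.inl a` stands for `x_a` and `Sum.inr a`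
for `∂_a`. -/
inductive HeisRel : FreeAlgebra ℂ (ι ⊕ ι) → FreeAlgebra ℂ (ι ⊕ ι) → Prop
  | xx (a b : ι) : HeisRel
      (FreeAlgebra.ι ℂ (Sum.inl a) * FreeAlgebra.ι ℂ (Sum.inl b))
      (S.exch a b • (FreeAlgebra.ι ℂ (Sum.inl b) * FreeAlgebra.ι ℂ (Sum.inl a)))
  | dd (a b : ι) : HeisRel
      (FreeAlgebra.ι ℂ (Sum.inr a) * FreeAlgebra.ι ℂ (Sum.inr b))
      (S.exch a b • (FreeAlgebra.ι ℂ (Sum.inr b) * FreeAlgebra.ι ℂ (Sum.inr a)))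
  | dx (a b : ι) : HeisRel
      (FreeAlgebra.ι ℂ (Sum.inr a) * FreeAlgebra.ι ℂ (Sum.inl b)
        - S.exch a b • (FreeAlgebra.ι ℂ (Sum.inl b) * FreeAlgebra.ι ℂ (Sum.inr a)))
      (algebraMap ℂ (FreeAlgebra ℂ (ι ⊕ ι)) (S.g a b))

/-- The graded Heisenberg algebra `ℋ`. -/
abbrev Heis := RingQuot S.HeisRel

/-- The variable `x_a`, of degree `[a]`. -/
def x (a : ι) : S.Heis := RingQuot.mkAlgHom ℂ S.HeisRel (FreeAlgebra.ι ℂ (Sum.inl a))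

/-- The derivative `∂_a`, of degree `[a]`. -/
def d (a : ι) : S.Heis := RingQuot.mkAlgHom ℂ S.HeisRel (FreeAlgebra.ι ℂ (Sum.inr a))

/-- The sign `ϵ (-1)^{[a][b] + [a] + [b]}`. -/
def exchM (a b : ι) : ℂ := S.eps * sgn (S.deg a * S.deg b + S.deg a + S.deg b)

/-- `M_{ab} = x_a ∂_b - ϵ (-1)^{[a][b] + [a] + [b]} x_b ∂_a`, of degree `[a] + [b]`. -/
def M (a b : ι) : S.Heis := S.x a * S.d b - S.exchM a b • (S.x b * S.d a)

/-- `{M_{(bc}, M_{d)a}}_∓`: the super-anticommutator of `M_{bc}` and `M_{da}`, super-symmetrized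
over `b, c, d` with the factors `-ϵ (-1)^{[s][t] + [s] + [t]}` for elementary transpositions. -/
def symAntiM (b c d a : ι) : S.Heis :=
  superSym (fun s t => -S.exchM s t)
    (fun t : Fin 3 → ι =>
      superAnti (S.deg (t 0) + S.deg (t 1)) (S.deg (t 2) + S.deg a)
        (S.M (t 0) (t 1)) (S.M (t 2) a))
    ![b, c, d]

/-! ### The graded tensor product `𝒜 ⊗ 𝒜 ⊗ ℋ` -/

/-- Generators of the graded tensor product: `Sum.inl (j, a)` is `c^a` of the `j`-th factor `𝒜`,
and `Sum.inr` gives the generators of `ℋ`. -/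
abbrev Gen (ι : Type*) := (Fin 2 × ι) ⊕ (ι ⊕ ι)

/-- Degree of a generator of `ℋ`. -/
def degH (y : ι ⊕ ι) : ZMod 2 := Sum.elim S.deg S.deg y

/-- The graded tensor product `𝒜 ⊗ 𝒜 ⊗ ℋ` by generators and relations: each factor keeps its
relations, and generators `X`, `Y` of different factors satisfy `X Y = (-1)^{[X][Y]} Y X`. -/
inductive TensorRel : FreeAlgebra ℂ (Gen ι) → FreeAlgebra ℂ (Gen ι) → Prop
  | osc (j : Fin 2) {s t : FreeAlgebra ℂ ι} (h : S.OscRel s t) : TensorRel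
      (FreeAlgebra.lift ℂ (fun a => FreeAlgebra.ι ℂ (Sum.inl (j, a) : Gen ι)) s)
      (FreeAlgebra.lift ℂ (fun a => FreeAlgebra.ι ℂ (Sum.inl (j, a) : Gen ι)) t)
  | heis {s t : FreeAlgebra ℂ (ι ⊕ ι)} (h : S.HeisRel s t) : TensorRel
      (FreeAlgebra.lift ℂ (fun y => FreeAlgebra.ι ℂ (Sum.inr y : Gen ι)) s)
      (FreeAlgebra.lift ℂ (fun y => FreeAlgebra.ι ℂ (Sum.inr y : Gen ι)) t)
  | cross_osc (a b : ι) : TensorRel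
      (FreeAlgebra.ι ℂ (Sum.inl (0, a)) * FreeAlgebra.ι ℂ (Sum.inl (1, b)))
      (sgn (S.deg a * S.deg b) •
        (FreeAlgebra.ι ℂ (Sum.inl (1, b)) * FreeAlgebra.ι ℂ (Sum.inl (0, a))))
  | cross_heis (j : Fin 2) (a : ι) (y : ι ⊕ ι) : TensorRel
      (FreeAlgebra.ι ℂ (Sum.inl (j, a)) * FreeAlgebra.ι ℂ (Sum.inr y))
      (sgn (S.deg a * S.degH y) •
        (FreeAlgebra.ι ℂ (Sum.inr y) * FreeAlgebra.ι ℂ (Sum.inl (j, a))))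

/-- The graded tensor product `𝒜 ⊗ 𝒜 ⊗ ℋ`. -/
abbrev Tensor := RingQuot S.TensorRel

/-- The embedding of `𝒜` as the first (`j = 0`) or second (`j = 1`) factor. -/
def inOsc (j : Fin 2) : S.Osc →ₐ[ℂ] S.Tensor :=
  RingQuot.liftAlgHom ℂ
    ⟨(RingQuot.mkAlgHom ℂ S.TensorRel).comp
      (FreeAlgebra.lift ℂ fun a => FreeAlgebra.ι ℂ (Sum.inl (j, a) : Gen ι)),
      fun _ _ h => RingQuot.mkAlgHom_rel ℂ (TensorRel.osc j h)⟩

/-- The embedding of `ℋ` as the third factor. -/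
def inHeis : S.Heis →ₐ[ℂ] S.Tensor :=
  RingQuot.liftAlgHom ℂ
    ⟨(RingQuot.mkAlgHom ℂ S.TensorRel).comp
      (FreeAlgebra.lift ℂ fun y => FreeAlgebra.ι ℂ (Sum.inr y : Gen ι)),
      fun _ _ h => RingQuot.mkAlgHom_rel ℂ (TensorRel.heis h)⟩

/-- The L-operator `L(u) = u I - ½ F^{ab} M_{ba}`, with `F^{ab}` in the `j`-th factor `𝒜`: for
`j = 0, 1` these are `L_1(u)` and `L_2(u)`. -/
def L (j : Fin 2) (u : ℂ) : S.Tensor :=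
  u • (1 : S.Tensor) - (1 / 2 : ℂ) • ∑ a : ι, ∑ b : ι, S.inOsc j (S.F a b) * S.inHeis (S.M b a)

/-! ### The super-spinorial R-operator -/

/-- The invariant
`ε_{a_1 b_1} ⋯ ε_{a_k b_k} c_1^{(a_1} ⋯ c_1^{a_k)} c_2^{(b_k} ⋯ c_2^{b_1)}`. -/
def invariant (k : ℕ) : S.Tensor :=
  ∑ a : Fin k → ι, ∑ b : Fin k → ι,
    (∏ i, S.g (a i) (b i)) •
      (S.inOsc 0 (S.symProd a) * S.inOsc 1 (S.symProd fun i => b i.rev))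

/-- The partial sum over `k < K` of the formal series
`R = ∑_k (r_k / k!) ε_{a_1 b_1} ⋯ ε_{a_k b_k} c_1^{(a_1} ⋯ c_1^{a_k)} c_2^{(b_k} ⋯ c_2^{b_1)}`. -/
def RPartial (r : ℕ → ℂ) (K : ℕ) : S.Tensor :=
  ∑ k ∈ Finset.range K, (r k / (k.factorial : ℂ)) • S.invariant k

/-- The subspace of `𝒜 ⊗ 𝒜 ⊗ ℋ` spanned by the elements
`c_1^{(a_1} ⋯ c_1^{a_k)} c_2^{(b_1} ⋯ c_2^{b_l)} h` with `k + l ≥ n` and `h ∈ ℋ`. Since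
super-symmetrized monomials form a basis of `𝒜`, these subspaces are the neighbourhoods of zero
for convergence of formal series in super-symmetrized monomials. -/
def highDegree (n : ℕ) : Submodule ℂ S.Tensor :=
  Submodule.span ℂ {t | ∃ (k l : ℕ) (a : Fin k → ι) (b : Fin l → ι) (h : S.Heis), n ≤ k + l ∧
    t = S.inOsc 0 (S.symProd a) * S.inOsc 1 (S.symProd b) * S.inHeis h}

/-- The spinorial RLL-relation `R(u) L_1(u+v) L_2(v) = L_1(v) L_2(u+v) R(u)` for the formal series
`R(u)` with coefficients `r`. The series is multiplied termwise, and equality of both sides means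
equality of all coefficients with respect to super-symmetrized monomials, i.e. the
difference of the partial sums tends to zero. (If the metric admits only finitely many nonzero
super-symmetrized monomials, this is equality in `𝒜 ⊗ 𝒜 ⊗ ℋ`.) -/
def RLL (r : ℕ → ℂ) (u v : ℂ) : Prop :=
  ∀ n : ℕ, ∃ K₀ : ℕ, ∀ K ≥ K₀,
    S.RPartial r K * S.L 0 (u + v) * S.L 1 v - S.L 0 v * S.L 1 (u + v) * S.RPartial r K
      ∈ S.highDegree n

/-- `r_{2m} = (-4)^m Γ(m - u/2) / Γ(m + 1 + (u-ω)/2) · A`,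
`r_{2m+1} = (-4)^m Γ(m - (u-1)/2) / Γ(m + 1 + (u-ω+1)/2) · B`.
Where the denominator has a pole, the quotient is zero, in agreement with `1/Γ`. -/
def gammaCoeff (A B u : ℂ) (k : ℕ) : ℂ :=
  if Even k then
    (-4) ^ (k / 2) * (Complex.Gamma ((k / 2 : ℕ) - u / 2)
      / Complex.Gamma ((k / 2 : ℕ) + 1 + (u - S.omega) / 2)) * A
  else
    (-4) ^ (k / 2) * (Complex.Gamma ((k / 2 : ℕ) - (u - 1) / 2)
      / Complex.Gamma ((k / 2 : ℕ) + 1 + (u - S.omega + 1) / 2)) * B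

end SuperMetric

end

/-!
A super-symmetrized polynomial in the oscillators is determined by its symbol, and on symbols the
graded mean and the graded difference of left and right multiplication by an oscillator act as a
creation and an annihilation operator. There the invariants become, up to signs, the divided powers
`e_k` of multiplication by `z = ε_{ab} c_1^a c_2^b`, and commuting one contraction with them gives
the three-term relation `z e_{k+1} = (k + 2) e_{k+2} + ϵ (ω - k) / 4 · e_k`.

With `X_j = x_a c_j^a`, `D_j = c_j^a ∂_a` and the Euler operator `E`, the L-operators are
`L_j(u) = u + X_j D_j - E / 2`. Commutation with `z` exchanges `X_1` and `X_2`, and `D_1` and `D_2`,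
so the two sides of the RLL-relation differ by multiples of expressions in `X_1 D_1 - X_2 D_2` and
the `e_k` only. By the three-term relation these are combinations of commutators with the `e_k`,
and the recurrence for the coefficients of the R-operator is what makes the sum telescope. The two
commutators which are left of a partial sum have high degree.

For the first part, `M_{bc}` may be replaced by `2 x_b ∂_c` under the super-symmetrization. The
normally ordered quartic terms of `{x_b ∂_c, M_{da}}` and two of the four contractions are odd under
a transposition of two of the indices `b, c, d`; the other two contractions are mapped to the
negative of each other by a cyclic permutation.
-/

noncomputable section

/-! ### Signs of words -/

theorem sgn_zero : sgn 0 = 1 := if_pos rfl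

theorem sgn_one : sgn 1 = -1 := if_neg one_ne_zero

theorem zmod_two_eq_zero_or_eq_one : ∀ x : ZMod 2, x = 0 ∨ x = 1 := by decide

theorem zmod_two_mul_self : ∀ x : ZMod 2, x * x = x := by decide

theorem sgn_add (x y : ZMod 2) : sgn (x + y) = sgn x * sgn y := by
  have one_add_one : (1 + 1 : ZMod 2) = 0 := rfl
  obtain rfl | rfl := zmod_two_eq_zero_or_eq_one x <;>
    obtain rfl | rfl := zmod_two_eq_zero_or_eq_one y <;> simp [sgn_zero, sgn_one, one_add_one]

theorem sgn_mul_self (x : ZMod 2) : sgn x * sgn x = 1 := by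
  unfold sgn; split_ifs <;> norm_num

theorem sgn_injective : Function.Injective sgn := by
  intro x y
  obtain rfl | rfl := zmod_two_eq_zero_or_eq_one x <;>
    obtain rfl | rfl := zmod_two_eq_zero_or_eq_one y <;> norm_num [sgn_zero, sgn_one]

theorem prod_prod_eq_of_forall_lt {R α : Type*} [CommMonoid R] [Fintype α] [LinearOrder α]
    [LocallyFiniteOrderTop α] [LocallyFiniteOrderBot α] {f g : α → α → R}
    (diag : ∀ i, f i i = g i i)
    (offDiag : ∀ i j, i < j → f i j * f j i = g i j * g j i) :
    ∏ i, ∏ j, f i j = ∏ i, ∏ j, g i j := by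
  have diag_mul (f : α → α → R) :
      ∏ i, ∏ j, f i j = (∏ i, f i i) * ∏ i, ∏ j ∈ Finset.Ioi i, f i j * f j i := by
    rw [Finset.prod_prod_Ioi_mul_eq_prod_prod_off_diag fun j i => f i j,
      ← Finset.prod_mul_distrib]
    exact Finset.prod_congr rfl fun i _ => Fintype.prod_eq_mul_prod_compl i _
  rw [diag_mul f, diag_mul g, Finset.prod_congr rfl fun i _ => diag i]
  congr 1
  exact Finset.prod_congr rfl fun i _ => Finset.prod_congr rfl fun j hj =>
    offDiag i j (Finset.mem_Ioi.mp hj)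

section Words

variable {ι : Type*} {w : ι → ι → ℂ}

theorem wordSign_one {k : ℕ} (a : Fin k → ι) : wordSign w 1 a = 1 :=
  Finset.prod_eq_one fun _ _ => Finset.prod_eq_one fun _ _ => if_neg fun h => h.1.not_gt h.2

theorem wordSign_mul (hw : ∀ s t, w s t * w t s = 1) {k : ℕ} (σ ρ : Equiv.Perm (Fin k))
    (a : Fin k → ι) : wordSign w (σ * ρ) a = wordSign w σ a * wordSign w ρ (a ∘ σ) := by
  have reindex : wordSign w σ a = ∏ i, ∏ j, if ρ i < ρ j ∧ σ (ρ j) < σ (ρ i)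
      then w (a (σ (ρ i))) (a (σ (ρ j))) else 1 := by
    unfold wordSign
    rw [← Equiv.prod_comp ρ]
    exact Finset.prod_congr rfl fun i _ => (Equiv.prod_comp ρ _).symm
  rw [reindex]
  unfold wordSign
  simp_rw [← Finset.prod_mul_distrib]
  apply prod_prod_eq_of_forall_lt
  · intro i; simp
  · intro i j hij
    have hne : ρ i ≠ ρ j := ρ.injective.ne hij.ne
    have hne' : σ (ρ i) ≠ σ (ρ j) := σ.injective.ne hne
    simp only [Equiv.Perm.mul_apply, Function.comp_apply, hij, hij.not_gt, true_and, false_and,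
      if_false, mul_one]
    rcases lt_or_gt_of_ne hne with h | h <;> rcases lt_or_gt_of_ne hne' with h' | h' <;>
      simp [h, h.not_gt, h', h'.not_gt, hw]

theorem wordSign_swap {n : ℕ} (i : Fin n) (a : Fin (n + 1) → ι) :
    wordSign w (Equiv.swap i.castSucc i.succ) a = w (a i.succ) (a i.castSucc) := by
  have inverted_iff (l j : Fin (n + 1)) :
      (l < j ∧ Equiv.swap i.castSucc i.succ j < Equiv.swap i.castSucc i.succ l) ↔
        l = i.castSucc ∧ j = i.succ := by
    simp only [Equiv.swap_apply_def]
    split_ifs <;> simp only [Fin.lt_def, Fin.ext_iff, Fin.val_castSucc, Fin.val_succ] at * <;> omega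
  simp only [wordSign, inverted_iff, ite_and]
  simp

theorem wordSign_finRotate {k : ℕ} (a : Fin (k + 1) → ι) :
    wordSign w (finRotate (k + 1)) a = ∏ i : Fin k, w (a i.succ) (a 0) := by
  have not_inverted (i j : Fin k) : ¬ (i < j ∧ j < i) := fun h => h.1.not_gt h.2
  simp [wordSign, Fin.prod_univ_castSucc, finRotate_apply, not_inverted, Fin.castSucc_lt_last,
    (Fin.castSucc_lt_last _).not_gt]

section Products

variable {B : Type*} [Ring B] [Algebra ℂ B] {v : ι → B}

theorem prod_ofFn_swap (hv : ∀ s t, v s * v t = w t s • (v t * v s)) {n : ℕ} (i : Fin n)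
    (a : Fin (n + 1) → ι) :
    w (a i.succ) (a i.castSucc) •
        (List.ofFn fun j => v (a (Equiv.swap i.castSucc i.succ j))).prod =
      (List.ofFn fun j => v (a j)).prod := by
  induction n with
  | zero => exact i.elim0
  | succ n ih =>
    refine Fin.cases ?_ (fun i => ?_) i
    · have fix (l : Fin n) : Equiv.swap (0 : Fin (n + 2)) 1 l.succ.succ = l.succ.succ :=
        Equiv.swap_apply_of_ne_of_ne (Fin.succ_ne_zero _)
          fun h => Fin.succ_ne_zero _ (Fin.succ_injective _ h)
      simp only [List.ofFn_succ, List.prod_cons, Fin.castSucc_zero, Fin.succ_zero_eq_one,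
        Equiv.swap_apply_left, Equiv.swap_apply_right, fix, ← mul_assoc]
      rw [← smul_mul_assoc, ← hv]
    · have fix_zero : Equiv.swap i.succ.castSucc i.succ.succ 0 = 0 :=
        Equiv.swap_apply_of_ne_of_ne (by simp [Fin.ext_iff]) (Fin.succ_ne_zero _).symm
      have swap_succ (l : Fin (n + 1)) : Equiv.swap i.succ.castSucc i.succ.succ l.succ =
          (Equiv.swap i.castSucc i.succ l).succ := by
        rw [← Fin.succ_castSucc]
        exact (Fin.succ_injective _).swap_apply _ _ _
      have tail := ih i fun j => a j.succ
      simp only [Fin.succ_castSucc] at tail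
      simp only [List.ofFn_succ (n := n + 1), List.prod_cons, fix_zero, swap_succ, ← tail,
        mul_smul_comm]

theorem wordSign_smul_prod_ofFn (hw : ∀ s t, w s t * w t s = 1)
    (hv : ∀ s t, v s * v t = w t s • (v t * v s)) {k : ℕ} (σ : Equiv.Perm (Fin k))
    (a : Fin k → ι) :
    wordSign w σ a • (List.ofFn fun i => v (a (σ i))).prod = (List.ofFn fun i => v (a i)).prod := by
  obtain _ | n := k
  · simp [wordSign]
  have hσ : σ ∈ Submonoid.closure (Set.range fun i : Fin n => Equiv.swap i.castSucc i.succ) := by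
    rw [Equiv.Perm.mclosure_swap_castSucc_succ]; trivial
  induction hσ using Submonoid.closure_induction generalizing a with
  | mem _ hmem =>
    obtain ⟨i, rfl⟩ := hmem
    rw [wordSign_swap, prod_ofFn_swap hv]
  | one => simp [wordSign_one]
  | mul σ ρ _ _ ihσ ihρ =>
    rw [wordSign_mul hw, ← ihσ a, mul_smul]
    exact congrArg _ (ihρ (a ∘ σ))

end Products

/-! ### Super-symmetrization -/

variable {V : Type*} [AddCommGroup V] [Module ℂ V]

theorem superSym_add {k : ℕ} (f g : (Fin k → ι) → V) (a : Fin k → ι) :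
    superSym w (fun b => f b + g b) a = superSym w f a + superSym w g a := by
  simp [superSym, Finset.sum_add_distrib]

theorem superSym_smul (r : ℂ) {k : ℕ} (f : (Fin k → ι) → V) (a : Fin k → ι) :
    superSym w (fun b => r • f b) a = r • superSym w f a := by
  simp only [superSym, Finset.smul_sum, smul_comm r]

theorem superSym_sum {α : Type*} (s : Finset α) {k : ℕ} (f : α → (Fin k → ι) → V)
    (a : Fin k → ι) :
    superSym w (fun b => ∑ x ∈ s, f x b) a = ∑ x ∈ s, superSym w (f x) a := by
  simp only [superSym, Finset.smul_sum]
  exact Finset.sum_comm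

theorem map_superSym {V' : Type*} [AddCommGroup V'] [Module ℂ V'] (φ : V →ₗ[ℂ] V') {k : ℕ}
    (f : (Fin k → ι) → V) (a : Fin k → ι) :
    φ (superSym w f a) = superSym w (fun b => φ (f b)) a := by
  simp [superSym]

theorem inv_factorial_smul_sum_perm (k : ℕ) (v : V) :
    (k.factorial : ℂ)⁻¹ • ∑ _σ : Equiv.Perm (Fin k), v = v := by
  rw [Finset.sum_const, Finset.card_univ, Fintype.card_perm, Fintype.card_fin,
    ← Nat.cast_smul_eq_nsmul ℂ, inv_smul_smul₀ (Nat.cast_ne_zero.mpr k.factorial_ne_zero)]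

theorem superSym_eq_self {k : ℕ} {f : (Fin k → ι) → V} {a : Fin k → ι}
    (h : ∀ σ : Equiv.Perm (Fin k), wordSign w σ a • f (fun i => a (σ i)) = f a) :
    superSym w f a = f a := by
  simp_rw [superSym, h]
  exact inv_factorial_smul_sum_perm k (f a)

theorem superSym_wordSign_smul_comp (hw : ∀ s t, w s t * w t s = 1) {k : ℕ}
    (ρ : Equiv.Perm (Fin k)) (f : (Fin k → ι) → V) (a : Fin k → ι) :
    superSym w (fun b => wordSign w ρ b • f (b ∘ ρ)) a = superSym w f a := by
  unfold superSym
  congr 1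
  rw [← Equiv.sum_comp (Equiv.mulRight ρ) fun σ => wordSign w σ a • f fun i => a (σ i)]
  refine Finset.sum_congr rfl fun σ _ => ?_
  rw [smul_smul, Equiv.coe_mulRight, wordSign_mul hw]
  rfl

theorem superSym_superSym_tail (hw : ∀ s t, w s t * w t s = 1) {k : ℕ}
    (f : (Fin (k + 1) → ι) → V) (a : Fin (k + 1) → ι) :
    superSym w (fun b => superSym w (fun c => f (Fin.cons (b 0) c)) (Fin.tail b)) a =
      superSym w f a := by
  let shift (ρ : Equiv.Perm (Fin k)) : Equiv.Perm (Fin (k + 1)) :=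
    Equiv.Perm.decomposeFin.symm (0, ρ)
  have superSym_tail (b : Fin (k + 1) → ι) :
      superSym w (fun c => f (Fin.cons (b 0) c)) (Fin.tail b) =
        (k.factorial : ℂ)⁻¹ • ∑ ρ, wordSign w (shift ρ) b • f (b ∘ shift ρ) := by
    unfold superSym
    congr 1
    refine Finset.sum_congr rfl fun ρ _ => ?_
    have sign_eq : wordSign w (shift ρ) b = wordSign w ρ (Fin.tail b) := by
      simp [wordSign, Fin.prod_univ_succ, shift, Fin.tail]
    have word_eq : b ∘ shift ρ = Fin.cons (b 0) fun i => Fin.tail b (ρ i) := by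
      funext i
      cases i using Fin.cases <;> simp [shift, Fin.tail]
    rw [sign_eq, word_eq]
  simp_rw [superSym_tail, superSym_smul, superSym_sum, superSym_wordSign_smul_comp hw]
  exact inv_factorial_smul_sum_perm k _

theorem superSym_eq_neg_of_forall_perm (hw : ∀ s t, w s t * w t s = 1) {k : ℕ}
    (ρ : Equiv.Perm (Fin k)) {f g : (Fin k → ι) → V}
    (h : ∀ b, wordSign w ρ b • f (b ∘ ρ) = -g b) (a : Fin k → ι) :
    superSym w f a = -superSym w g a := by
  rw [← superSym_wordSign_smul_comp hw ρ f a]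
  simp_rw [h, superSym, smul_neg, Finset.sum_neg_distrib, smul_neg]

theorem superSym_eq_zero_of_forall_perm (hw : ∀ s t, w s t * w t s = 1) {k : ℕ}
    (ρ : Equiv.Perm (Fin k)) {f : (Fin k → ι) → V}
    (h : ∀ b, wordSign w ρ b • f (b ∘ ρ) = -f b) (a : Fin k → ι) : superSym w f a = 0 := by
  have eq_neg := superSym_eq_neg_of_forall_perm hw ρ h a
  linear_combination (norm := module) (1 / 2 : ℂ) • eq_neg

theorem wordSign_swap_zero_one (t : Fin 3 → ι) : wordSign w (Equiv.swap 0 1) t = w (t 1) (t 0) :=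
  wordSign_swap 0 t

theorem wordSign_swap_one_two (t : Fin 3 → ι) : wordSign w (Equiv.swap 1 2) t = w (t 2) (t 1) :=
  wordSign_swap 1 t

theorem wordSign_swap_zero_two (t : Fin 3 → ι) :
    wordSign w (Equiv.swap 0 2) t = w (t 2) (t 1) * w (t 2) (t 0) * w (t 1) (t 0) := by
  simp [wordSign, Fin.prod_univ_three, Equiv.swap_apply_def]

end Words

/-! ### Creation and annihilation operators -/

/-- A family of oscillators `gen s` in an algebra, with commutation relations
`gen s * gen t = contraction s t + sign s t * gen t * gen s`, together with the endomorphisms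
`twist s` of the algebra that multiply each generator by the sign which it costs to move `gen s`
past it. -/
structure Oscillators (κ B : Type*) [Ring B] [Algebra ℂ B] where
  gen : κ → B
  sign : κ → κ → ℂ
  contraction : κ → κ → ℂ
  twist : κ → B →ₐ[ℂ] B
  gen_mul_gen : ∀ s t, gen s * gen t = contraction s t • 1 + sign s t • (gen t * gen s)
  sign_comm : ∀ s t, sign s t = sign t s
  sign_mul_self : ∀ s t, sign s t * sign s t = 1
  twist_gen : ∀ s t, twist s (gen t) = sign s t • gen t
  twist_comm : ∀ s t b, twist s (twist t b) = twist t (twist s b)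
  twist_twist : ∀ s t b, contraction s t ≠ 0 → twist s (twist t b) = b

namespace Oscillators

variable {κ B : Type*} [Ring B] [Algebra ℂ B] (O : Oscillators κ B)

theorem sign_mul_sign (s t : κ) : O.sign s t * O.sign t s = 1 := by
  rw [O.sign_comm t s, O.sign_mul_self]

/-- Left multiplication by an oscillator. -/
def leftMul (s : κ) : Module.End ℂ B := LinearMap.mulLeft ℂ (O.gen s)

/-- Right multiplication by an oscillator, with the sign of moving it to the left end. -/
def rightMul (s : κ) : Module.End ℂ B :=
  LinearMap.mulRight ℂ (O.gen s) ∘ₗ (O.twist s).toLinearMap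

/-- The creation operator of an oscillator: multiplication in the algebra of symbols, when the
elements of the algebra are written as super-symmetrized polynomials in the oscillators. -/
def creation (s : κ) : Module.End ℂ B := (1 / 2 : ℂ) • (O.leftMul s + O.rightMul s)

/-- The annihilation operator of an oscillator: the super-commutator with it, which acts on
super-symmetrized polynomials as a derivative. -/
def annihilation (s : κ) : Module.End ℂ B := O.leftMul s - O.rightMul s

theorem leftMul_apply (s : κ) (b : B) : O.leftMul s b = O.gen s * b := rfl

theorem rightMul_apply (s : κ) (b : B) : O.rightMul s b = O.twist s b * O.gen s := rfl

theorem creation_apply (s : κ) (b : B) :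
    O.creation s b = (1 / 2 : ℂ) • (O.leftMul s b + O.rightMul s b) := rfl

theorem annihilation_apply (s : κ) (b : B) :
    O.annihilation s b = O.gen s * b - O.twist s b * O.gen s := rfl

theorem leftMul_eq (s : κ) : O.leftMul s = O.creation s + (1 / 2 : ℂ) • O.annihilation s := by
  unfold creation annihilation; module

theorem rightMul_eq (s : κ) : O.rightMul s = O.creation s - (1 / 2 : ℂ) • O.annihilation s := by
  unfold creation annihilation; module

theorem leftMul_mul_leftMul (s t : κ) : O.leftMul s * O.leftMul t =
    O.contraction s t • 1 + O.sign s t • (O.leftMul t * O.leftMul s) := by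
  ext b
  simp only [Module.End.mul_apply, LinearMap.add_apply, LinearMap.smul_apply, leftMul_apply,
    Module.End.one_apply, ← mul_assoc, O.gen_mul_gen s t, add_mul, smul_mul_assoc, one_mul]

theorem rightMul_mul_rightMul (s t : κ) : O.rightMul s * O.rightMul t =
    -O.contraction s t • 1 + O.sign s t • (O.rightMul t * O.rightMul s) := by
  ext b
  have expand : O.rightMul t (O.rightMul s b) =
      O.sign s t • (O.twist s (O.twist t b) * (O.gen s * O.gen t)) := by
    simp only [rightMul_apply, map_mul, twist_gen, mul_smul_comm, smul_mul_assoc, mul_assoc,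
      O.sign_comm t s, O.twist_comm t s]
  have expand' : O.rightMul s (O.rightMul t b) =
      O.sign s t • (O.twist s (O.twist t b) * (O.gen t * O.gen s)) := by
    simp only [rightMul_apply, map_mul, twist_gen, mul_smul_comm, smul_mul_assoc, mul_assoc]
  have untwist : O.contraction s t • O.twist s (O.twist t b) = O.contraction s t • b := by
    by_cases h : O.contraction s t = 0
    · simp [h]
    · rw [O.twist_twist s t b h]
  simp only [Module.End.mul_apply, LinearMap.add_apply, LinearMap.smul_apply,
    Module.End.one_apply, expand, expand', smul_smul, sign_mul_self, one_smul, O.gen_mul_gen s t,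
    mul_add, mul_smul_comm, mul_one, untwist]
  module

theorem leftMul_mul_rightMul (s t : κ) :
    O.leftMul s * O.rightMul t = O.sign s t • (O.rightMul t * O.leftMul s) := by
  ext b
  simp only [Module.End.mul_apply, LinearMap.smul_apply, leftMul_apply, rightMul_apply, map_mul,
    twist_gen, smul_mul_assoc, smul_smul, sign_mul_sign, one_smul, mul_assoc]

theorem rightMul_mul_leftMul (s t : κ) :
    O.rightMul s * O.leftMul t = O.sign s t • (O.leftMul t * O.rightMul s) := by
  rw [leftMul_mul_rightMul, smul_smul, sign_mul_sign, one_smul]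

theorem creation_mul_creation (s t : κ) :
    O.creation s * O.creation t = O.sign s t • (O.creation t * O.creation s) := by
  simp only [creation, smul_mul_smul_comm, mul_add, add_mul, O.leftMul_mul_leftMul s t,
    O.rightMul_mul_rightMul s t, O.leftMul_mul_rightMul s t, O.rightMul_mul_leftMul s t]
  module

theorem annihilation_mul_creation (s t : κ) : O.annihilation s * O.creation t =
    O.contraction s t • 1 + O.sign s t • (O.creation t * O.annihilation s) := by
  simp only [creation, annihilation, smul_mul_assoc, mul_smul_comm, mul_add, mul_sub, add_mul,
    sub_mul, O.leftMul_mul_leftMul s t, O.rightMul_mul_rightMul s t, O.leftMul_mul_rightMul s t,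
    O.rightMul_mul_leftMul s t]
  module

theorem annihilation_one (s : κ) : O.annihilation s 1 = 0 := by
  rw [annihilation_apply, map_one, one_mul, mul_one, sub_self]

theorem annihilation_creation_eq_zero {s t : κ} (hst : O.contraction s t = 0) {b : B}
    (hb : O.annihilation s b = 0) : O.annihilation s (O.creation t b) = 0 := by
  have h := LinearMap.congr_fun (O.annihilation_mul_creation s t) b
  simpa [hst, hb] using h

theorem annihilation_mul_eq_zero {s : κ} {b b' : B} (h : O.annihilation s b = 0)
    (h' : O.annihilation s b' = 0) : O.annihilation s (b * b') = 0 := by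
  rw [annihilation_apply, sub_eq_zero] at *
  rw [← mul_assoc, h, mul_assoc, h', map_mul, mul_assoc]

theorem creation_mul {s : κ} (b : B) {b' : B} (h : O.annihilation s b' = 0) :
    O.creation s (b * b') = O.creation s b * b' := by
  rw [annihilation_apply, sub_eq_zero] at h
  simp only [creation_apply, leftMul_apply, rightMul_apply, map_mul, smul_mul_assoc, add_mul,
    mul_assoc, h]

/-! ### Super-symmetrized products -/

/-- The product of the creation operators of the letters of a word. -/
def creationProd {k : ℕ} (a : Fin k → κ) : Module.End ℂ B :=
  (List.ofFn fun i => O.creation (a i)).prod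

theorem creationProd_succ {k : ℕ} (a : Fin (k + 1) → κ) :
    O.creationProd a = O.creation (a 0) * O.creationProd (Fin.tail a) := by
  simp [creationProd, List.ofFn_succ, Fin.tail]

theorem creationProd_zero (a : Fin 0 → κ) : O.creationProd a = 1 := by
  simp [creationProd]

theorem annihilation_creationProd_eq_zero {s : κ} {k : ℕ} {a : Fin k → κ}
    (ha : ∀ i, O.contraction s (a i) = 0) {b : B} (hb : O.annihilation s b = 0) :
    O.annihilation s (O.creationProd a b) = 0 := by
  induction k with
  | zero => rwa [creationProd_zero]
  | succ k ih =>
    rw [creationProd_succ]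
    exact O.annihilation_creation_eq_zero (ha 0) (ih fun i => ha i.succ)

theorem creationProd_one_mul {k : ℕ} {a : Fin k → κ} {b : B}
    (hb : ∀ i, O.annihilation (a i) b = 0) : O.creationProd a 1 * b = O.creationProd a b := by
  induction k with
  | zero => simp [creationProd_zero]
  | succ k ih =>
    rw [creationProd_succ, Module.End.mul_apply, Module.End.mul_apply,
      ← O.creation_mul _ (hb 0), ih (a := Fin.tail a) fun i => hb i.succ]

theorem superSym_creationProd {k : ℕ} (a : Fin k → κ) :
    superSym O.sign O.creationProd a = O.creationProd a :=
  superSym_eq_self fun σ => wordSign_smul_prod_ofFn O.sign_mul_sign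
    (fun s t => by rw [O.creation_mul_creation s t, O.sign_comm s t]) σ a

/-- The product of the letters of a word. -/
def genProd {k : ℕ} (a : Fin k → κ) : B := (List.ofFn fun i => O.gen (a i)).prod

theorem leftMul_genProd {k : ℕ} (a : Fin (k + 1) → κ) :
    O.leftMul (a 0) (O.genProd (Fin.tail a)) = O.genProd a := by
  simp [genProd, leftMul_apply, List.ofFn_succ, Fin.tail]

theorem twist_genProd (s : κ) {k : ℕ} (a : Fin k → κ) :
    O.twist s (O.genProd a) = (∏ i, O.sign s (a i)) • O.genProd a := by
  induction k with
  | zero => simp [genProd]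
  | succ k ih =>
    rw [← leftMul_genProd, leftMul_apply, map_mul, twist_gen, ih, smul_mul_smul_comm,
      Fin.prod_univ_succ]
    rfl

theorem rightMul_genProd {k : ℕ} (a : Fin (k + 1) → κ) :
    O.rightMul (a 0) (O.genProd (Fin.tail a)) =
      wordSign O.sign (finRotate (k + 1)) a • O.genProd (a ∘ finRotate (k + 1)) := by
  have rotated : O.genProd (a ∘ finRotate (k + 1)) = O.genProd (Fin.tail a) * O.gen (a 0) := by
    simp only [genProd, List.ofFn_succ', List.concat_eq_append, List.prod_append,
      List.prod_singleton]
    simp [Fin.tail]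
  rw [rightMul_apply, twist_genProd, wordSign_finRotate, rotated, smul_mul_assoc]
  simp only [Fin.tail, O.sign_comm (a 0)]

-- Rotating the first letter to the end turns `rightMul` into `leftMul`, so that the
-- super-symmetrization does not change when `leftMul` is replaced by the mean of the two.
theorem superSym_creation_genProd_tail {k : ℕ} (a : Fin (k + 1) → κ) :
    superSym O.sign (fun b => O.creation (b 0) (O.genProd (Fin.tail b))) a =
      superSym O.sign O.genProd a := by
  simp only [creation_apply, leftMul_genProd, rightMul_genProd, superSym_smul, superSym_add,
    superSym_wordSign_smul_comp O.sign_mul_sign]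
  module

theorem superSym_genProd {k : ℕ} (a : Fin k → κ) :
    superSym O.sign O.genProd a = O.creationProd a 1 := by
  induction k with
  | zero => simp [superSym, wordSign, genProd, creationProd]
  | succ k ih =>
    have tail (b : Fin (k + 1) → κ) : superSym O.sign (fun c : Fin k → κ =>
        O.creation (b 0) (O.genProd c)) (Fin.tail b) = O.creationProd b 1 := by
      rw [← map_superSym, ih, creationProd_succ, Module.End.mul_apply]
    rw [← superSym_creation_genProd_tail, ← superSym_superSym_tail O.sign_mul_sign]
    simp only [Fin.cons_zero, Fin.tail_cons, tail]
    exact (map_superSym (LinearMap.applyₗ (1 : B)) O.creationProd a).symm.trans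
      (congrArg _ (O.superSym_creationProd a))

end Oscillators

namespace SuperMetric

variable {ι : Type*} [Fintype ι] [DecidableEq ι] (S : SuperMetric ι)

/-! ### The metric and its inverse -/

theorem eps_mul_self : S.eps * S.eps = 1 := by
  rcases S.eps_eq with h | h <;> rw [h] <;> norm_num

theorem exch_comm (a b : ι) : S.exch a b = S.exch b a := by
  rw [exch, exch, mul_comm (S.deg a)]

theorem exch_mul_self (a b : ι) : S.exch a b * S.exch a b = 1 := by
  rw [exch, mul_mul_mul_comm, eps_mul_self, sgn_mul_self, one_mul]

theorem deg_eq_of_g_ne_zero {a b : ι} (h : S.g a b ≠ 0) : S.deg a = S.deg b :=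
  CharTwo.add_eq_zero.mp (S.even a b h)

theorem g_swap (a b : ι) : S.g b a = S.eps * (sgn (S.deg a) * S.g a b) := by
  rw [S.symm b a]
  by_cases h : S.g a b = 0
  · simp [h]
  · rw [← S.deg_eq_of_g_ne_zero h, zmod_two_mul_self, mul_assoc]

theorem g_mul_ginv : S.g * S.g⁻¹ = 1 := Matrix.mul_nonsing_inv _ S.nondeg

theorem ginv_mul_g : S.g⁻¹ * S.g = 1 := Matrix.nonsing_inv_mul _ S.nondeg

/-- The diagonal matrix of the signs `(-1)^{[a]}`. -/
def parity : Matrix ι ι ℂ := Matrix.diagonal fun a => sgn (S.deg a)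

theorem commute_parity_g : Commute S.parity S.g := by
  ext a b
  rw [parity, Matrix.diagonal_mul, Matrix.mul_diagonal]
  by_cases h : S.g a b = 0
  · simp [h]
  · rw [S.deg_eq_of_g_ne_zero h, mul_comm]

theorem deg_eq_of_ginv_ne_zero {a b : ι} (h : S.g⁻¹ a b ≠ 0) : S.deg a = S.deg b := by
  have commute : S.parity * S.g⁻¹ = S.g⁻¹ * S.parity :=
    calc S.parity * S.g⁻¹ = S.g⁻¹ * (S.g * S.parity) * S.g⁻¹ := by
          rw [← mul_assoc S.g⁻¹, S.ginv_mul_g, one_mul]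
      _ = S.g⁻¹ * S.parity := by
          rw [← S.commute_parity_g.eq, mul_assoc, mul_assoc, S.g_mul_ginv, mul_one]
  have entry := congrFun (congrFun commute a) b
  rw [parity, Matrix.diagonal_mul, Matrix.mul_diagonal, mul_comm] at entry
  exact sgn_injective (mul_left_cancel₀ h entry)

theorem ginv_swap (a b : ι) : S.g⁻¹ b a = S.eps * (sgn (S.deg a) * S.g⁻¹ a b) := by
  have parity_mul_self : S.parity * S.parity = 1 := by
    simp [parity, Matrix.diagonal_mul_diagonal, sgn_mul_self]
  have transpose_g : S.g.transpose = S.eps • (S.parity * S.g) := by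
    ext a b
    rw [parity, Matrix.smul_apply, Matrix.diagonal_mul, Matrix.transpose_apply, smul_eq_mul,
      S.g_swap a b]
  have transpose_ginv : S.g⁻¹.transpose = S.eps • (S.g⁻¹ * S.parity) := by
    rw [Matrix.transpose_nonsing_inv]
    refine Matrix.inv_eq_right_inv ?_
    rw [transpose_g, smul_mul_smul_comm, S.eps_mul_self, one_smul, mul_assoc, ← mul_assoc S.g,
      S.g_mul_ginv, one_mul, parity_mul_self]
  have entry := congrFun (congrFun transpose_ginv a) b
  rw [Matrix.transpose_apply, parity, Matrix.smul_apply, Matrix.mul_diagonal, smul_eq_mul] at entry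
  rw [entry]
  by_cases h : S.g⁻¹ a b = 0
  · simp [h]
  · rw [S.deg_eq_of_ginv_ne_zero h, mul_comm (S.g⁻¹ a b)]

theorem sum_ginv_mul_g (a c : ι) : ∑ b, S.g⁻¹ a b * S.g b c = if a = c then 1 else 0 := by
  rw [← Matrix.mul_apply, S.ginv_mul_g, Matrix.one_apply]

theorem sum_g_mul_ginv (a c : ι) : ∑ b, S.g a b * S.g⁻¹ b c = if a = c then 1 else 0 := by
  rw [← Matrix.mul_apply, S.g_mul_ginv, Matrix.one_apply]

section Exchange

variable {A : Type*} [Ring A] [Algebra ℂ A] {x y : A} {r w : ℂ}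

theorem mul_add_smul_mul_eq_iff :
    x * y + w • (y * x) = r • 1 ↔ x * y = r • 1 + -w • (y * x) := by
  rw [neg_smul, ← sub_eq_add_neg, eq_sub_iff_add_eq]

theorem smul_mul_smul_eq {α β : ℂ} (h : x * y = r • 1 + w • (y * x)) (hr : r ≠ 0 → α * β = 1) :
    (α • x) * (β • y) = r • 1 + w • ((β • y) * (α • x)) := by
  rw [smul_mul_smul_comm, smul_mul_smul_comm, mul_comm β, smul_comm w, h, smul_add]
  by_cases h0 : r = 0
  · simp [h0]
  · rw [hr h0, one_smul]

end Exchange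

/-! ### The graded tensor product -/

/-- The generators of the graded tensor product, as elements of it. -/
def tensorGen (Y : Gen ι) : S.Tensor := RingQuot.mkAlgHom ℂ S.TensorRel (FreeAlgebra.ι ℂ Y)

/-- The super-oscillator `c_j^a`, with `j` counted from `0`. -/
def osc (j : Fin 2) (a : ι) : S.Tensor := S.tensorGen (Sum.inl (j, a))

/-- The copies of `x_a` and `∂_a` in the graded tensor product. -/
def heisGen (y : ι ⊕ ι) : S.Tensor := S.tensorGen (Sum.inr y)

theorem inOsc_c (j : Fin 2) (a : ι) : S.inOsc j (S.c a) = S.osc j a :=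
  (RingQuot.liftAlgHom_mkAlgHom_apply ℂ _ _ _).trans (by simp [osc, tensorGen])

theorem inHeis_mkAlgHom_ι (y : ι ⊕ ι) :
    S.inHeis (RingQuot.mkAlgHom ℂ S.HeisRel (FreeAlgebra.ι ℂ y)) = S.heisGen y :=
  (RingQuot.liftAlgHom_mkAlgHom_apply ℂ _ _ _).trans (by simp [heisGen, tensorGen])

/-- The sign of the exchange of `c_j^a` and `c_l^b`. -/
def oscSign (v v' : Fin 2 × ι) : ℂ :=
  if v.1 = v'.1 then -S.exch v.2 v'.2 else sgn (S.deg v.2 * S.deg v'.2)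

/-- The scalar which appears in the exchange of `c_j^a` and `c_l^b`. -/
def oscContraction (v v' : Fin 2 × ι) : ℂ := if v.1 = v'.1 then S.g⁻¹ v.2 v'.2 else 0

theorem oscSign_comm (v v' : Fin 2 × ι) : S.oscSign v v' = S.oscSign v' v := by
  simp only [oscSign, eq_comm (a := v.1), S.exch_comm v.2, mul_comm (S.deg v.2)]

theorem oscSign_mul_self (v v' : Fin 2 × ι) : S.oscSign v v' * S.oscSign v v' = 1 := by
  unfold oscSign
  split_ifs
  · rw [neg_mul_neg, exch_mul_self]
  · exact sgn_mul_self _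

theorem osc_zero_mul_osc_one (a b : ι) : S.osc 0 a * S.osc 1 b =
    sgn (S.deg a * S.deg b) • (S.osc 1 b * S.osc 0 a) := by
  simpa [osc, tensorGen] using RingQuot.mkAlgHom_rel ℂ (TensorRel.cross_osc (S := S) a b)

theorem osc_mul_osc (j l : Fin 2) (a b : ι) : S.osc j a * S.osc l b =
    S.oscContraction (j, a) (l, b) • 1 + S.oscSign (j, a) (l, b) • (S.osc l b * S.osc j a) := by
  rcases eq_or_ne j l with rfl | hjl
  · have h := RingQuot.mkAlgHom_rel ℂ (TensorRel.osc (S := S) j (OscRel.rel a b))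
    simp only [map_mul, map_smul, map_add, FreeAlgebra.lift_ι_apply,
      Algebra.algebraMap_eq_smul_one, map_one] at h
    rw [oscContraction, oscSign, if_pos rfl, if_pos rfl]
    exact mul_add_smul_mul_eq_iff.mp h
  · rw [oscContraction, oscSign, if_neg hjl, if_neg hjl, zero_smul, zero_add]
    have h01 : (j = 0 ∧ l = 1) ∨ (j = 1 ∧ l = 0) := by omega
    rcases h01 with ⟨rfl, rfl⟩ | ⟨rfl, rfl⟩
    · exact S.osc_zero_mul_osc_one a b
    · rw [osc_zero_mul_osc_one, smul_smul, mul_comm (S.deg a), sgn_mul_self, one_smul]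

theorem osc_mul_heisGen (j : Fin 2) (a : ι) (y : ι ⊕ ι) :
    S.osc j a * S.heisGen y = sgn (S.deg a * S.degH y) • (S.heisGen y * S.osc j a) := by
  simpa [osc, heisGen, tensorGen] using
    RingQuot.mkAlgHom_rel ℂ (TensorRel.cross_heis (S := S) j a y)

theorem adjoin_range_tensorGen : Algebra.adjoin ℂ (Set.range S.tensorGen) = ⊤ := by
  rw [show S.tensorGen = RingQuot.mkAlgHom ℂ S.TensorRel ∘ FreeAlgebra.ι ℂ from rfl,
    Set.range_comp, ← AlgHom.map_adjoin, FreeAlgebra.adjoin_range_ι, Algebra.map_top]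
  exact AlgHom.range_eq_top _ |>.mpr (RingQuot.mkAlgHom_surjective ℂ _)

theorem adjoin_range_heisGen : Algebra.adjoin ℂ (Set.range S.heisGen) = S.inHeis.range := by
  have h : S.heisGen = S.inHeis ∘ RingQuot.mkAlgHom ℂ S.HeisRel ∘ FreeAlgebra.ι ℂ :=
    funext fun y => (S.inHeis_mkAlgHom_ι y).symm
  rw [h, Set.range_comp, Set.range_comp, ← AlgHom.map_adjoin, ← AlgHom.map_adjoin,
    FreeAlgebra.adjoin_range_ι, Algebra.map_top,
    (AlgHom.range_eq_top _).mpr (RingQuot.mkAlgHom_surjective ℂ _), Algebra.map_top]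

theorem tensor_hom_ext {A : Type*} [Semiring A] [Algebra ℂ A] {f f' : S.Tensor →ₐ[ℂ] A}
    (h : ∀ Y, f (S.tensorGen Y) = f' (S.tensorGen Y)) : f = f' :=
  RingQuot.ringQuot_ext' ℂ _ _ (FreeAlgebra.hom_ext (funext h))

/-! ### The twists of the graded tensor product -/

/-- The sign of the exchange of `c_j^a` with a generator of the graded tensor product. -/
def genSign (v : Fin 2 × ι) : Gen ι → ℂ :=
  Sum.elim (S.oscSign v) fun y => sgn (S.deg v.2 * S.degH y)

theorem genSign_mul_self (v : Fin 2 × ι) (Y : Gen ι) : S.genSign v Y * S.genSign v Y = 1 := by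
  rcases Y with v' | y
  · exact S.oscSign_mul_self _ _
  · exact sgn_mul_self _

theorem genSign_mul_genSign {v v' : Fin 2 × ι} (h : S.oscContraction v v' ≠ 0) (Y : Gen ι) :
    S.genSign v Y * S.genSign v' Y = 1 := by
  obtain ⟨hj, hg⟩ : v.1 = v'.1 ∧ S.g⁻¹ v.2 v'.2 ≠ 0 := by simpa [oscContraction] using h
  have hdeg := S.deg_eq_of_ginv_ne_zero hg
  have : S.genSign v Y = S.genSign v' Y := by
    rcases Y with v'' | y <;> simp [genSign, oscSign, exch, hj, hdeg]
  rw [this, genSign_mul_self]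

theorem lift_genSign_smul_tensorGen_eq (v : Fin 2 × ι) {s t : FreeAlgebra ℂ (Gen ι)}
    (h : S.TensorRel s t) :
    FreeAlgebra.lift ℂ (fun Y => S.genSign v Y • S.tensorGen Y) s =
      FreeAlgebra.lift ℂ (fun Y => S.genSign v Y • S.tensorGen Y) t := by
  have hr := RingQuot.mkAlgHom_rel ℂ h
  have scaled {Y Y' : Gen ι} {w : ℂ}
      (hY : S.tensorGen Y * S.tensorGen Y' = w • (S.tensorGen Y' * S.tensorGen Y)) :
      (S.genSign v Y • S.tensorGen Y) * (S.genSign v Y' • S.tensorGen Y') =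
        w • ((S.genSign v Y' • S.tensorGen Y') * (S.genSign v Y • S.tensorGen Y)) := by
    rw [smul_mul_smul_comm, smul_mul_smul_comm, hY, mul_comm, smul_comm]
  rcases h with ⟨j, ⟨a, b⟩⟩ | ⟨⟨a, b⟩ | ⟨a, b⟩ | ⟨a, b⟩⟩ | ⟨a, b⟩ | ⟨j, a, y⟩
  · simp only [map_mul, map_smul, map_add, FreeAlgebra.lift_ι_apply,
      Algebra.algebraMap_eq_smul_one, map_one] at hr ⊢
    refine mul_add_smul_mul_eq_iff.mpr
      (smul_mul_smul_eq (mul_add_smul_mul_eq_iff.mp hr) fun hab => ?_)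
    simp only [genSign, Sum.elim_inl]
    rw [S.oscSign_comm v, S.oscSign_comm v]
    exact S.genSign_mul_genSign (by simpa [oscContraction] using hab) (Sum.inl v)
  · simp only [map_mul, map_smul, FreeAlgebra.lift_ι_apply] at hr ⊢
    exact scaled hr
  · simp only [map_mul, map_smul, FreeAlgebra.lift_ι_apply] at hr ⊢
    exact scaled hr
  · simp only [map_mul, map_smul, map_sub, FreeAlgebra.lift_ι_apply,
      Algebra.algebraMap_eq_smul_one, map_one] at hr ⊢
    rw [sub_eq_iff_eq_add] at hr ⊢
    refine smul_mul_smul_eq hr fun hab => ?_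
    simp [genSign, degH, S.deg_eq_of_g_ne_zero hab, sgn_mul_self]
  · simp only [map_mul, map_smul, FreeAlgebra.lift_ι_apply] at hr ⊢
    exact scaled hr
  · simp only [map_mul, map_smul, FreeAlgebra.lift_ι_apply] at hr ⊢
    exact scaled hr

/-- The endomorphism that multiplies every generator by the sign of its exchange with `c_j^a`. -/
def twist (v : Fin 2 × ι) : S.Tensor →ₐ[ℂ] S.Tensor :=
  RingQuot.liftAlgHom ℂ ⟨FreeAlgebra.lift ℂ fun Y => S.genSign v Y • S.tensorGen Y,
    fun _ _ h => S.lift_genSign_smul_tensorGen_eq v h⟩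

theorem twist_tensorGen (v : Fin 2 × ι) (Y : Gen ι) :
    S.twist v (S.tensorGen Y) = S.genSign v Y • S.tensorGen Y := by
  simp [twist, tensorGen]

theorem twist_comp_twist_eq_id {v v' : Fin 2 × ι}
    (h : ∀ Y, S.genSign v Y * S.genSign v' Y = 1) :
    (S.twist v).comp (S.twist v') = AlgHom.id ℂ S.Tensor :=
  S.tensor_hom_ext fun Y => by
    simp [twist_tensorGen, smul_smul, mul_comm (S.genSign v' Y), h]

theorem twist_comp_twist_comm (v v' : Fin 2 × ι) :
    (S.twist v).comp (S.twist v') = (S.twist v').comp (S.twist v) :=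
  S.tensor_hom_ext fun Y => by simp [twist_tensorGen, smul_smul, mul_comm]

/-- The oscillators `c_j^a` of the graded tensor product. -/
def oscillators : Oscillators (Fin 2 × ι) S.Tensor where
  gen v := S.osc v.1 v.2
  sign := S.oscSign
  contraction := S.oscContraction
  twist := S.twist
  gen_mul_gen _ _ := S.osc_mul_osc _ _ _ _
  sign_comm := S.oscSign_comm
  sign_mul_self := S.oscSign_mul_self
  twist_gen v v' := S.twist_tensorGen v (Sum.inl v')
  twist_comm v v' t := AlgHom.congr_fun (S.twist_comp_twist_comm v v') t
  twist_twist _ _ t h := AlgHom.congr_fun (S.twist_comp_twist_eq_id (S.genSign_mul_genSign h)) t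

/-- The creation operator of `c_j^a`. -/
abbrev cre (j : Fin 2) (a : ι) : Module.End ℂ S.Tensor := S.oscillators.creation (j, a)

/-- The annihilation operator of `c_j^a`. -/
abbrev ann (j : Fin 2) (a : ι) : Module.End ℂ S.Tensor := S.oscillators.annihilation (j, a)

theorem cre_mul_cre (j l : Fin 2) (a b : ι) :
    S.cre j a * S.cre l b = S.oscSign (j, a) (l, b) • (S.cre l b * S.cre j a) :=
  S.oscillators.creation_mul_creation _ _

theorem ann_mul_cre (j l : Fin 2) (a b : ι) : S.ann j a * S.cre l b =
    S.oscContraction (j, a) (l, b) • 1 + S.oscSign (j, a) (l, b) • (S.cre l b * S.ann j a) :=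
  S.oscillators.annihilation_mul_creation _ _

theorem ann_one (j : Fin 2) (a : ι) : S.ann j a 1 = 0 := S.oscillators.annihilation_one _

theorem ann_heisGen (j : Fin 2) (a : ι) (y : ι ⊕ ι) : S.ann j a (S.heisGen y) = 0 := by
  rw [Oscillators.annihilation_apply, sub_eq_zero]
  refine (S.osc_mul_heisGen j a y).trans ?_
  rw [← smul_mul_assoc]
  exact congrArg (· * S.osc j a) (S.twist_tensorGen (j, a) (Sum.inr y)).symm

theorem ann_inHeis (j : Fin 2) (a : ι) (h : S.Heis) : S.ann j a (S.inHeis h) = 0 := by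
  have mem : S.inHeis h ∈ Algebra.adjoin ℂ (Set.range S.heisGen) := by
    rw [adjoin_range_heisGen]
    exact ⟨h, rfl⟩
  generalize S.inHeis h = t at mem
  induction mem using Algebra.adjoin_induction with
  | mem _ hx => obtain ⟨y, rfl⟩ := hx; exact S.ann_heisGen j a y
  | algebraMap r => rw [Algebra.algebraMap_eq_smul_one, map_smul, ann_one, smul_zero]
  | add x y _ _ hx hy => rw [map_add, hx, hy, add_zero]
  | mul x y _ _ hx hy => exact S.oscillators.annihilation_mul_eq_zero hx hy

theorem inOsc_symProd (j : Fin 2) {k : ℕ} (a : Fin k → ι) :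
    S.inOsc j (S.symProd a) = S.oscillators.creationProd (fun i => (j, a i)) 1 := by
  have hword (b : Fin k → ι) : (S.inOsc j) (List.ofFn fun i => S.c (b i)).prod =
      S.oscillators.genProd fun i => (j, b i) := by
    rw [map_list_prod, List.map_ofFn]
    simp only [Function.comp_def, inOsc_c]
    rfl
  rw [← Oscillators.superSym_genProd, symProd, ← AlgHom.toLinearMap_apply, map_superSym]
  simp only [AlgHom.toLinearMap_apply, hword, superSym, wordSign, oscillators, oscSign, if_pos]

end SuperMetric

theorem apply_pow_apply_eq_zero_of_commute {R V : Type*} [Semiring R] [AddCommMonoid V] [Module R V]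
    {T Z : Module.End R V} (h : Commute T Z) {v : V} (hv : T v = 0) (k : ℕ) :
    T ((Z ^ k) v) = 0 := by
  rw [← Module.End.mul_apply, (h.pow_right k).eq, Module.End.mul_apply, hv, map_zero]

theorem cast_succ_mul_inv_factorial_succ {𝕜 : Type*} [Field 𝕜] [CharZero 𝕜] (k : ℕ) :
    ((k + 1 : ℕ) : 𝕜) * ((k + 1).factorial : 𝕜)⁻¹ = (k.factorial : 𝕜)⁻¹ := by
  rw [Nat.factorial_succ, Nat.cast_mul, mul_inv, mul_inv_cancel_left₀]
  exact_mod_cast k.succ_ne_zero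

namespace SuperMetric

variable {ι : Type*} [Fintype ι] [DecidableEq ι] (S : SuperMetric ι)

/-! ### Contractions with the metric -/

section Pair

variable {B : Type*} [Semiring B] [Algebra ℂ B]

/-- The contraction `ε_{ab} f^a f'^b` of two families with the metric. -/
def pair (f f' : ι → B) : B := ∑ a, ∑ b, S.g a b • (f a * f' b)

theorem pair_swap (f f' : ι → B) :
    ∑ a, ∑ b, (S.exch a b * S.g a b) • (f b * f' a) = S.pair f f' := by
  rw [Finset.sum_comm]
  refine Finset.sum_congr rfl fun a _ => Finset.sum_congr rfl fun b _ => ?_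
  rw [S.symm a b, S.exch_comm b a, exch]

theorem pair_self_eq_zero {f : ι → B}
    (hf : ∀ a b, f a * f b = -S.exch a b • (f b * f a)) : S.pair f f = 0 := by
  have neg_self : S.pair f f = (-1 : ℂ) • S.pair f f := by
    conv_rhs => rw [← pair_swap]
    simp only [pair, Finset.smul_sum]
    refine Finset.sum_congr rfl fun a _ => Finset.sum_congr rfl fun b _ => ?_
    rw [hf a b, smul_smul, smul_smul]
    congr 1
    ring
  have two_smul_eq_zero : (2 : ℂ) • S.pair f f = 0 := by
    rw [two_smul]
    nth_rewrite 2 [neg_self]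
    rw [← one_smul ℂ (S.pair f f), smul_smul, ← add_smul, mul_one, add_neg_cancel, zero_smul]
  exact (IsUnit.mk0 (2 : ℂ) two_ne_zero).smul_eq_zero.mp two_smul_eq_zero

theorem pair_add_left (f h f' : ι → B) : S.pair (f + h) f' = S.pair f f' + S.pair h f' := by
  simp [pair, add_mul, Finset.sum_add_distrib]

theorem pair_add_right (f f' h : ι → B) : S.pair f (f' + h) = S.pair f f' + S.pair f h := by
  simp [pair, mul_add, Finset.sum_add_distrib]

theorem pair_smul_left (r : ℂ) (f f' : ι → B) : S.pair (r • f) f' = r • S.pair f f' := by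
  simp [pair, Finset.smul_sum, smul_comm r]

theorem pair_smul_right (r : ℂ) (f f' : ι → B) : S.pair f (r • f') = r • S.pair f f' := by
  simp [pair, Finset.smul_sum, smul_comm r]

theorem pair_zero_left (f' : ι → B) : S.pair 0 f' = 0 := by simp [pair]

theorem pair_zero_right (f : ι → B) : S.pair f 0 = 0 := by simp [pair]

theorem oscSign_mul_oscSign_of_deg_eq (v : Fin 2 × ι) {a b : ι} (h : S.deg a = S.deg b) :
    S.oscSign v (0, a) * S.oscSign v (1, b) = -S.eps := by
  obtain ⟨j, c⟩ := v
  have hsgn := sgn_mul_self (S.deg c * S.deg b)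
  fin_cases j <;> simp [oscSign, exch, h] <;> linear_combination S.eps * hsgn

variable {C : Fin 2 → ι → B} {T : B}

theorem mul_pair (v : Fin 2 × ι) {f : Fin 2 → ι → ℂ}
    (hT : ∀ l b, T * C l b = f l b • 1 + S.oscSign v (l, b) • (C l b * T)) :
    T * S.pair (C 0) (C 1) = -S.eps • (S.pair (C 0) (C 1) * T) +
      ∑ a, ∑ b, (S.g a b * f 0 a) • C 1 b +
      ∑ a, ∑ b, (S.g a b * S.oscSign v (0, a) * f 1 b) • C 0 a := by
  simp only [pair, Finset.mul_sum, Finset.sum_mul, Finset.smul_sum, ← Finset.sum_add_distrib]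
  refine Finset.sum_congr rfl fun a _ => Finset.sum_congr rfl fun b _ => ?_
  have exchange_twice : T * (C 0 a * C 1 b) = f 0 a • C 1 b +
      (S.oscSign v (0, a) * f 1 b) • C 0 a +
      (S.oscSign v (0, a) * S.oscSign v (1, b)) • (C 0 a * C 1 b * T) := by
    rw [← mul_assoc, hT, add_mul, smul_mul_assoc, one_mul, smul_mul_assoc, mul_assoc, hT,
      mul_add, mul_smul_comm, mul_smul_comm, mul_one, mul_assoc]
    module
  rw [mul_smul_comm, exchange_twice, smul_mul_assoc]
  by_cases hg : S.g a b = 0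
  · simp [hg]
  · rw [S.oscSign_mul_oscSign_of_deg_eq v (S.deg_eq_of_g_ne_zero hg)]
    module

theorem mul_pair_zero {a : ι} (hT : ∀ l b, T * C l b =
      S.oscContraction (0, a) (l, b) • 1 + S.oscSign (0, a) (l, b) • (C l b * T)) :
    T * S.pair (C 0) (C 1) = -S.eps • (S.pair (C 0) (C 1) * T) + C 1 a := by
  have contract (b : ι) :
      ∑ c, S.g c b * S.oscContraction (0, a) (0, c) = if a = b then 1 else 0 := by
    rw [← S.sum_ginv_mul_g]
    exact Finset.sum_congr rfl fun c _ => by simp [oscContraction, mul_comm]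
  rw [S.mul_pair (0, a) hT, Finset.sum_comm]
  simp_rw [← Finset.sum_smul, contract]
  simp [oscContraction]

theorem mul_pair_one {b : ι} (hT : ∀ l a, T * C l a =
      S.oscContraction (1, b) (l, a) • 1 + S.oscSign (1, b) (l, a) • (C l a * T)) :
    T * S.pair (C 0) (C 1) = -S.eps • (S.pair (C 0) (C 1) * T) + S.eps • C 0 b := by
  have contract (a : ι) :
      ∑ c, S.g a c * S.oscSign (1, b) (0, a) * S.oscContraction (1, b) (1, c) =
        if a = b then S.eps else 0 := by
    have swapped (c : ι) : S.g a c * S.oscSign (1, b) (0, a) * S.oscContraction (1, b) (1, c) =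
        S.eps * sgn (S.deg b) * sgn (S.deg b * S.deg a) * (S.g a c * S.g⁻¹ c b) := by
      simp only [oscSign, oscContraction, if_true, Fin.one_eq_zero_iff, OfNat.ofNat_ne_one,
        if_false]
      rw [S.ginv_swap c b]
      by_cases h : S.g⁻¹ c b = 0
      · simp [h]
      · rw [S.deg_eq_of_ginv_ne_zero h]; ring
    simp_rw [swapped, ← Finset.mul_sum, S.sum_g_mul_ginv]
    split_ifs with hab
    · rw [hab, zmod_two_mul_self, mul_one, mul_assoc, sgn_mul_self, mul_one]
    · rw [mul_zero]
  rw [S.mul_pair (1, b) hT]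
  simp_rw [← Finset.sum_smul, contract]
  simp [oscContraction]

/-- The nested contraction
`ε_{a_1 b_1} ⋯ ε_{a_k b_k} f^{a_1} ⋯ f^{a_k} f'^{b_k} ⋯ f'^{b_1}` of two families. -/
def nestedPair (f f' : ι → B) (k : ℕ) : B :=
  ∑ a : Fin k → ι, ∑ b : Fin k → ι, (∏ i, S.g (a i) (b i)) •
    ((List.ofFn fun i => f (a i)).prod * (List.ofFn fun i => f' (b i.rev)).prod)

theorem nestedPair_zero (f f' : ι → B) : S.nestedPair f f' 0 = 1 := by
  simp [nestedPair]

theorem nestedPair_succ (f f' : ι → B) (k : ℕ) :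
    S.nestedPair f f' (k + 1) = S.pair f fun b => S.nestedPair f f' k * f' b := by
  have sum_cons (F : (Fin (k + 1) → ι) → B) : ∑ a, F a = ∑ x, ∑ a, F (Fin.cons x a) := by
    rw [← Fintype.sum_prod_type', ← (Fin.consEquiv fun _ => ι).sum_comp]
    rfl
  have word_cons (x y : ι) (a b : Fin k → ι) :
      (∏ i, S.g ((Fin.cons x a : Fin (k + 1) → ι) i) ((Fin.cons y b : Fin (k + 1) → ι) i)) •
        ((List.ofFn fun i => f ((Fin.cons x a : Fin (k + 1) → ι) i)).prod *
          (List.ofFn fun i => f' ((Fin.cons y b : Fin (k + 1) → ι) i.rev)).prod) =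
      S.g x y • (f x * ((∏ i, S.g (a i) (b i)) • ((List.ofFn fun i => f (a i)).prod *
        (List.ofFn fun i => f' (b i.rev)).prod) * f' y)) := by
    rw [List.ofFn_succ, List.ofFn_succ', List.concat_eq_append, List.prod_append, List.prod_cons,
      Fin.prod_univ_succ]
    simp only [Fin.cons_zero, Fin.cons_succ, Fin.rev_castSucc, Fin.rev_last, List.prod_singleton,
      mul_smul_comm, smul_mul_assoc, smul_smul, mul_assoc]
  rw [nestedPair, sum_cons, pair]
  refine Finset.sum_congr rfl fun x _ => ?_
  simp_rw [sum_cons, word_cons]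
  rw [Finset.sum_comm]
  simp_rw [← Finset.smul_sum, ← Finset.mul_sum, ← Finset.sum_mul]
  rfl

theorem sum_g_mul_ginv_eq_omega : ∑ a, ∑ b, S.g a b * S.g⁻¹ a b = S.omega := by
  have swapped (a b : ι) :
      S.g a b * S.g⁻¹ a b = S.eps * sgn (S.deg a) * (S.g a b * S.g⁻¹ b a) := by
    rw [S.ginv_swap b a]
    by_cases h : S.g⁻¹ b a = 0
    · simp [h]
    · rw [S.deg_eq_of_ginv_ne_zero h]; ring
  have sgn_deg (a : ι) : sgn (S.deg a) =
      (if S.deg a = 0 then (1 : ℂ) else 0) - if S.deg a = 1 then 1 else 0 := by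
    rcases zmod_two_eq_zero_or_eq_one (S.deg a) with h | h <;> simp [h, sgn_zero, sgn_one]
  simp_rw [swapped, ← Finset.mul_sum, S.sum_g_mul_ginv, if_true, mul_one, ← Finset.mul_sum,
    sgn_deg, Finset.sum_sub_distrib, Finset.sum_boole, omega]

end Pair

/-! ### The invariants as divided powers -/

/-- Multiplication by `ε_{ab} c_1^a c_2^b` in the algebra of symbols. -/
def pairCre : Module.End ℂ S.Tensor := S.pair (S.cre 0) (S.cre 1)

/-- The second order operator that contracts `c_1` with `c_2` in the algebra of symbols. -/
def pairAnn : Module.End ℂ S.Tensor := S.pair (S.ann 0) (S.ann 1)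

/-- The operator which counts the letters `c_j` in the algebra of symbols. -/
def number (j : Fin 2) : Module.End ℂ S.Tensor := S.pair (S.cre j) (S.ann j)

theorem cre_mul_pairCre (j : Fin 2) (a : ι) :
    S.cre j a * S.pairCre = -S.eps • (S.pairCre * S.cre j a) := by
  rw [pairCre, S.mul_pair (j, a) (f := 0) fun l b => by rw [cre_mul_cre]; simp]
  simp

theorem ann_zero_mul_pairCre (a : ι) :
    S.ann 0 a * S.pairCre = -S.eps • (S.pairCre * S.ann 0 a) + S.cre 1 a :=
  S.mul_pair_zero fun _ _ => S.ann_mul_cre _ _ _ _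

theorem ann_one_mul_pairCre (b : ι) :
    S.ann 1 b * S.pairCre = -S.eps • (S.pairCre * S.ann 1 b) + S.eps • S.cre 0 b :=
  S.mul_pair_one fun _ _ => S.ann_mul_cre _ _ _ _

theorem pair_cre_self (j : Fin 2) : S.pair (S.cre j) (S.cre j) = 0 :=
  S.pair_self_eq_zero fun a b => by rw [cre_mul_cre, oscSign, if_pos rfl]

theorem pair_cre_one_cre_zero : S.pair (S.cre 1) (S.cre 0) = S.eps • S.pairCre := by
  have exchange (a b : ι) : S.exch a b • (S.cre 1 b * S.cre 0 a) =
      S.eps • (S.cre 0 a * S.cre 1 b) := by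
    have hsgn : S.exch a b * S.oscSign (1, b) (0, a) = S.eps := by
      rw [oscSign, if_neg (by simp), exch, mul_comm (S.deg b), mul_assoc, sgn_mul_self, mul_one]
    rw [cre_mul_cre, smul_smul, hsgn]
  rw [pairCre, ← S.pair_swap (S.cre 1), pair, Finset.smul_sum]
  refine Finset.sum_congr rfl fun a _ => ?_
  rw [Finset.smul_sum]
  refine Finset.sum_congr rfl fun b _ => ?_
  rw [mul_comm, mul_smul, exchange, smul_comm]

theorem pair_mul_pairCre {f f' h h' : ι → Module.End ℂ S.Tensor}
    (hf : ∀ a, f a * S.pairCre = -S.eps • (S.pairCre * f a) + h a)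
    (hf' : ∀ a, f' a * S.pairCre = -S.eps • (S.pairCre * f' a) + h' a) :
    S.pair f f' * S.pairCre = S.pairCre * S.pair f f' + -S.eps • S.pair h f' + S.pair f h' := by
  simp only [pair, Finset.sum_mul, Finset.mul_sum, Finset.smul_sum, ← Finset.sum_add_distrib]
  refine Finset.sum_congr rfl fun a _ => Finset.sum_congr rfl fun b _ => ?_
  rw [smul_mul_assoc, mul_assoc, hf', mul_add, mul_smul_comm, ← mul_assoc, hf, add_mul,
    smul_mul_assoc, mul_assoc, mul_smul_comm]
  have heps := S.eps_mul_self
  match_scalars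
  · linear_combination S.g a b * heps
  · ring
  · ring

theorem number_mul_pairCre (j : Fin 2) :
    S.number j * S.pairCre = S.pairCre * S.number j + S.pairCre := by
  have super_commute (j : Fin 2) (a : ι) :
      S.cre j a * S.pairCre =
        -S.eps • (S.pairCre * S.cre j a) + (0 : ι → Module.End ℂ S.Tensor) a := by
    rw [cre_mul_pairCre, Pi.zero_apply, add_zero]
  match j with
  | 0 =>
    refine (S.pair_mul_pairCre (super_commute 0) S.ann_zero_mul_pairCre).trans ?_
    rw [pair_zero_left, smul_zero, add_zero]
    rfl
  | 1 =>
    refine (S.pair_mul_pairCre (h' := S.eps • S.cre 0) (super_commute 1)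
      S.ann_one_mul_pairCre).trans ?_
    rw [pair_zero_left, smul_zero, add_zero, pair_smul_right, pair_cre_one_cre_zero, smul_smul,
      eps_mul_self, one_smul]
    rfl

theorem commute_pair_cre_ann_pairCre : Commute (S.pair (S.cre 0) (S.ann 1)) S.pairCre := by
  refine (S.pair_mul_pairCre (h := 0) (h' := S.eps • S.cre 0)
    (fun a => by rw [cre_mul_pairCre, Pi.zero_apply, add_zero]) S.ann_one_mul_pairCre).trans ?_
  rw [pair_smul_right, pair_cre_self, pair_zero_left, smul_zero, smul_zero, add_zero, add_zero]

theorem commute_pair_ann_cre_pairCre : Commute (S.pair (S.ann 0) (S.cre 1)) S.pairCre := by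
  refine (S.pair_mul_pairCre (h' := 0) S.ann_zero_mul_pairCre
    (fun a => by rw [cre_mul_pairCre, Pi.zero_apply, add_zero])).trans ?_
  rw [pair_cre_self, pair_zero_right, smul_zero, add_zero, add_zero]

theorem pair_ann_cre_self :
    S.pair (S.ann 0) (S.cre 0) = S.omega • 1 + (-1 : ℂ) • S.number 0 := by
  rw [number, ← S.pair_swap (S.cre 0), ← sum_g_mul_ginv_eq_omega]
  simp only [pair, Finset.sum_smul, Finset.smul_sum, ← Finset.sum_add_distrib]
  refine Finset.sum_congr rfl fun a _ => Finset.sum_congr rfl fun b _ => ?_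
  rw [ann_mul_cre]
  simp only [oscContraction, oscSign, if_true]
  module

theorem pairAnn_mul_pairCre : S.pairAnn * S.pairCre =
    S.pairCre * S.pairAnn + (S.eps * S.omega) • 1 + -S.eps • (S.number 0 + S.number 1) := by
  refine (S.pair_mul_pairCre (h' := S.eps • S.cre 0) S.ann_zero_mul_pairCre
    S.ann_one_mul_pairCre).trans ?_
  rw [pair_smul_right, pair_ann_cre_self, pairAnn, number, number]
  module

theorem pair_ann_apply_one (f : ι → Module.End ℂ S.Tensor) (j : Fin 2) :
    S.pair f (S.ann j) 1 = 0 := by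
  simp [pair, LinearMap.sum_apply, ann_one]

theorem pair_ann_cre_apply_one : S.pair (S.ann 0) (S.cre 1) 1 = 0 := by
  have exchange (a b : ι) : (S.ann 0 a * S.cre 1 b) 1 = 0 := by
    rw [ann_mul_cre]
    simp [oscContraction, ann_one]
  simp only [pair, LinearMap.sum_apply, LinearMap.smul_apply, exchange, smul_zero,
    Finset.sum_const_zero]

theorem number_pairCre_pow (j : Fin 2) (k : ℕ) :
    S.number j ((S.pairCre ^ k) 1) = (k : ℂ) • (S.pairCre ^ k) 1 := by
  induction k with
  | zero => rw [pow_zero, number, Module.End.one_apply, pair_ann_apply_one]; simp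
  | succ k ih =>
    have h := LinearMap.congr_fun (S.number_mul_pairCre j) ((S.pairCre ^ k) 1)
    simp only [Module.End.mul_apply, LinearMap.add_apply] at h
    rw [pow_succ', Module.End.mul_apply, h, ih, map_smul]
    push_cast
    module

theorem pairAnn_pairCre_pow_succ (k : ℕ) : S.pairAnn ((S.pairCre ^ (k + 1)) 1) =
    (S.eps * (k + 1) * (S.omega - k)) • (S.pairCre ^ k) 1 := by
  have h (k : ℕ) := LinearMap.congr_fun S.pairAnn_mul_pairCre ((S.pairCre ^ k) 1)
  simp only [Module.End.mul_apply, LinearMap.add_apply, LinearMap.smul_apply,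
    Module.End.one_apply, number_pairCre_pow] at h
  induction k with
  | zero =>
    rw [pow_succ', Module.End.mul_apply, h, pow_zero, Module.End.one_apply, pairAnn,
      pair_ann_apply_one, map_zero]
    push_cast
    module
  | succ k ih =>
    rw [pow_succ' _ (k + 1), Module.End.mul_apply, h, ih, map_smul, ← Module.End.mul_apply,
      ← pow_succ']
    push_cast
    module

/-- The first invariant `ε_{ab} c_1^a c_2^b`. -/
def z : S.Tensor := S.pair (S.osc 0) (S.osc 1)

theorem mulLeft_z : LinearMap.mulLeft ℂ S.z = S.pairCre +
    (1 / 2 : ℂ) • (S.pair (S.ann 0) (S.cre 1) + S.pair (S.cre 0) (S.ann 1)) +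
      (1 / 4 : ℂ) • S.pairAnn := by
  have mulLeft_osc (j : Fin 2) : (fun a => LinearMap.mulLeft ℂ (S.osc j a)) =
      S.cre j + (1 / 2 : ℂ) • S.ann j :=
    funext fun a => S.oscillators.leftMul_eq (j, a)
  have mulLeft_pair : LinearMap.mulLeft ℂ S.z =
      S.pair (fun a => LinearMap.mulLeft ℂ (S.osc 0 a))
        fun a => LinearMap.mulLeft ℂ (S.osc 1 a) := by
    ext t
    simp only [z, pair, LinearMap.mulLeft_apply, Finset.sum_mul, LinearMap.sum_apply,
      LinearMap.smul_apply, Module.End.mul_apply, smul_mul_assoc, mul_assoc]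
  rw [mulLeft_pair, mulLeft_osc, mulLeft_osc, pair_add_left, pair_add_right, pair_add_right,
    pair_smul_left, pair_smul_left, pair_smul_right, pair_smul_right, pairCre, pairAnn]
  module

theorem z_mul_pairCre_pow (k : ℕ) : S.z * (S.pairCre ^ k) 1 =
    (S.pairCre ^ (k + 1)) 1 + (1 / 4 : ℂ) • S.pairAnn ((S.pairCre ^ k) 1) := by
  have h := LinearMap.congr_fun S.mulLeft_z ((S.pairCre ^ k) 1)
  have ann_cre := apply_pow_apply_eq_zero_of_commute S.commute_pair_ann_cre_pairCre
    S.pair_ann_cre_apply_one k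
  have cre_ann := apply_pow_apply_eq_zero_of_commute S.commute_pair_cre_ann_pairCre
    (S.pair_ann_apply_one (S.cre 0) 1) k
  simp only [LinearMap.mulLeft_apply, LinearMap.add_apply, LinearMap.smul_apply, ann_cre, cre_ann,
    add_zero, smul_zero] at h
  rw [h, pow_succ', Module.End.mul_apply]

/-- The divided powers `z^k / k!` of `z = ε_{ab} c_1^a c_2^b`, formed in the algebra of symbols. -/
def divPow (k : ℕ) : S.Tensor := (k.factorial : ℂ)⁻¹ • (S.pairCre ^ k) 1

theorem divPow_zero : S.divPow 0 = 1 := by simp [divPow]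

theorem divPow_one : S.divPow 1 = S.z := by
  have h := S.z_mul_pairCre_pow 0
  rw [pow_zero, Module.End.one_apply, mul_one, pairAnn, pair_ann_apply_one, smul_zero, add_zero]
    at h
  rw [h, divPow, Nat.factorial_one, Nat.cast_one, inv_one, one_smul]

theorem divPow_one_mul_divPow_succ (k : ℕ) : S.divPow 1 * S.divPow (k + 1) =
    ((k : ℂ) + 2) • S.divPow (k + 2) + (S.eps * (S.omega - k) / 4) • S.divPow k := by
  have h1 := cast_succ_mul_inv_factorial_succ (𝕜 := ℂ) k
  have h2 := cast_succ_mul_inv_factorial_succ (𝕜 := ℂ) (k + 1)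
  push_cast at h1 h2
  rw [divPow_one, divPow, mul_smul_comm, z_mul_pairCre_pow, pairAnn_pairCre_pow_succ, divPow,
    divPow]
  match_scalars
  · linear_combination -h2
  · linear_combination (S.eps * (S.omega - k) / 4) * h1

theorem cre_mul_pairCre_pow (j : Fin 2) (a : ι) (k : ℕ) :
    S.cre j a * S.pairCre ^ k = (-S.eps) ^ k • (S.pairCre ^ k * S.cre j a) := by
  induction k with
  | zero => rw [pow_zero, pow_zero, one_smul, mul_one, one_mul]
  | succ k ih =>
    rw [pow_succ, ← mul_assoc, ih, smul_mul_assoc, mul_assoc, cre_mul_pairCre, mul_smul_comm,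
      smul_smul, ← pow_succ, mul_assoc]

theorem nestedPair_cre (k : ℕ) :
    S.nestedPair (S.cre 0) (S.cre 1) k = (-S.eps) ^ k.choose 2 • S.pairCre ^ k := by
  induction k with
  | zero => rw [nestedPair_zero, Nat.choose_zero_succ, pow_zero, pow_zero, one_smul]
  | succ k ih =>
    have move_out (a b : ι) : S.cre 0 a * ((-S.eps) ^ k.choose 2 • S.pairCre ^ k * S.cre 1 b) =
        (-S.eps) ^ (k + 1).choose 2 • (S.pairCre ^ k * (S.cre 0 a * S.cre 1 b)) := by
      rw [smul_mul_assoc, mul_smul_comm, ← mul_assoc, cre_mul_pairCre_pow, smul_mul_assoc,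
        smul_smul, ← pow_add, mul_assoc, Nat.choose_succ_succ, Nat.choose_one_right, add_comm]
    rw [nestedPair_succ, ih, pow_succ S.pairCre]
    nth_rewrite 3 [pairCre]
    simp only [pair, move_out, Finset.mul_sum, Finset.smul_sum, mul_smul_comm, smul_comm (S.g _ _)]

theorem invariant_eq_smul_divPow (k : ℕ) :
    S.invariant k = ((-S.eps) ^ k.choose 2 * k.factorial) • S.divPow k := by
  have inOsc_mul_inOsc (a b : Fin k → ι) :
      S.inOsc 0 (S.symProd a) * S.inOsc 1 (S.symProd b) =
        S.oscillators.creationProd (fun i => (0, a i))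
          (S.oscillators.creationProd (fun i => (1, b i)) 1) := by
    rw [inOsc_symProd, inOsc_symProd]
    exact S.oscillators.creationProd_one_mul fun i =>
      S.oscillators.annihilation_creationProd_eq_zero (s := (0, a i)) (a := fun l => (1, b l))
        (fun l => show S.oscContraction (0, a i) (1, b l) = 0 from if_neg zero_ne_one)
        (S.oscillators.annihilation_one (0, a i))
  have h := LinearMap.congr_fun (S.nestedPair_cre k) 1
  simp only [nestedPair, LinearMap.sum_apply, LinearMap.smul_apply, Module.End.mul_apply] at h
  rw [divPow, smul_smul, mul_assoc, mul_inv_cancel₀ (by exact_mod_cast k.factorial_ne_zero),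
    mul_one, ← h, invariant]
  simp only [inOsc_mul_inOsc]
  rfl

end SuperMetric

/-! ### The RLL-relation for index-free generators -/

section FunctionalEquation

variable {𝕜 B : Type*} [Field 𝕜] [Ring B] [Algebra 𝕜 B] {ϵ ω : 𝕜}

/-- The three-term recurrence satisfied by the super-symmetrized divided powers `e k` of `e 1`. -/
structure IsDividedPowers (ϵ ω : 𝕜) (e : ℕ → B) : Prop where
  zero : e 0 = 1
  one_mul_succ : ∀ k : ℕ,
    e 1 * e (k + 1) = ((k : 𝕜) + 2) • e (k + 2) + (ϵ * (ω - k) / 4) • e k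

/-- A pair of elements which is exchanged by `z`, as the oscillators `c_1`, `c_2` are by the
invariant `z = ε_{ab} c_1^a c_2^b`. -/
structure IsExchangedBy (ϵ : 𝕜) (z U₀ U₁ : B) : Prop where
  mul_zero : z * U₀ = ϵ • U₁ - ϵ • (U₀ * z)
  mul_one : z * U₁ = U₀ - ϵ • (U₁ * z)

/-- The pairs with `[z, P] = 2 P'` and `[z, P'] = 2 ϵ P`: if `s ^ 2 = ϵ`, then `P' ± s P` are
eigenvectors of `[z, ·]` with eigenvalues `± 2 s`. -/
structure IsShiftPair (ϵ : 𝕜) (z P P' : B) : Prop where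
  mul_left : z * P = P * z + (2 : 𝕜) • P'
  mul_right : z * P' = P' * z + (2 * ϵ) • P

theorem IsShiftPair.swap {z P P' : B} (h : IsShiftPair ϵ z P P') : IsShiftPair ϵ z P' (ϵ • P) where
  mul_left := by rw [h.mul_right, mul_smul]
  mul_right := by rw [mul_smul_comm, h.mul_left, smul_mul_assoc, smul_add, smul_smul, mul_comm ϵ]

namespace IsExchangedBy

section Closure

variable {z : B}

theorem sum {κ : Type*} {s : Finset κ} {U₀ U₁ : κ → B} (h : ∀ i, IsExchangedBy ϵ z (U₀ i) (U₁ i)) :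
    IsExchangedBy ϵ z (∑ i ∈ s, U₀ i) (∑ i ∈ s, U₁ i) where
  mul_zero := by
    simp only [Finset.mul_sum, Finset.sum_mul, Finset.smul_sum, ← Finset.sum_sub_distrib,
      (h _).mul_zero]
  mul_one := by
    simp only [Finset.mul_sum, Finset.sum_mul, Finset.smul_sum, ← Finset.sum_sub_distrib,
      (h _).mul_one]

variable {t U₀ U₁ : B}

theorem mul_left (ht : Commute z t) (h : IsExchangedBy ϵ z U₀ U₁) :
    IsExchangedBy ϵ z (t * U₀) (t * U₁) where
  mul_zero := by
    rw [ht.left_comm, h.mul_zero, mul_sub, mul_smul_comm, mul_smul_comm, mul_assoc]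
  mul_one := by rw [ht.left_comm, h.mul_one, mul_sub, mul_smul_comm, mul_assoc]

theorem mul_right (ht : Commute z t) (h : IsExchangedBy ϵ z U₀ U₁) :
    IsExchangedBy ϵ z (U₀ * t) (U₁ * t) where
  mul_zero := by
    rw [← mul_assoc, h.mul_zero, sub_mul, smul_mul_assoc, smul_mul_assoc, mul_assoc U₀, ht.eq,
      mul_assoc]
  mul_one := by
    rw [← mul_assoc, h.mul_one, sub_mul, smul_mul_assoc, mul_assoc U₁, ht.eq, mul_assoc]

end Closure

variable {z U₀ U₁ V₀ V₁ : B} (hU : IsExchangedBy ϵ z U₀ U₁) (hV : IsExchangedBy ϵ z V₀ V₁)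
  (hϵ : ϵ * ϵ = 1)

include hU hV hϵ

theorem mul_zero_zero : z * (U₀ * V₀) = U₀ * V₀ * z + (ϵ • (U₁ * V₀) - U₀ * V₁) := by
  rw [← mul_assoc, hU.mul_zero, sub_mul, smul_mul_assoc, smul_mul_assoc, mul_assoc, hV.mul_zero,
    mul_sub, mul_smul_comm, mul_smul_comm, mul_assoc]
  linear_combination (norm := module) hϵ • (U₀ * (V₀ * z)) - hϵ • (U₀ * V₁)

theorem mul_one_one : z * (U₁ * V₁) = U₁ * V₁ * z - (ϵ • (U₁ * V₀) - U₀ * V₁) := by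
  rw [← mul_assoc, hU.mul_one, sub_mul, smul_mul_assoc, mul_assoc, hV.mul_one, mul_sub,
    mul_smul_comm, mul_assoc]
  linear_combination (norm := module) hϵ • (U₁ * (V₁ * z))

theorem mul_zero_one : z * (U₀ * V₁) = U₀ * V₁ * z + ϵ • (U₁ * V₁ - U₀ * V₀) := by
  rw [← mul_assoc, hU.mul_zero, sub_mul, smul_mul_assoc, smul_mul_assoc, mul_assoc, hV.mul_one,
    mul_sub, mul_smul_comm, mul_assoc]
  linear_combination (norm := module) hϵ • (U₀ * (V₁ * z))

theorem mul_one_zero : z * (U₁ * V₀) = U₁ * V₀ * z + (U₀ * V₀ - U₁ * V₁) := by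
  rw [← mul_assoc, hU.mul_one, sub_mul, smul_mul_assoc, mul_assoc, hV.mul_zero, mul_sub,
    mul_smul_comm, mul_smul_comm, mul_assoc]
  linear_combination (norm := module) hϵ • (U₁ * (V₀ * z)) - hϵ • (U₁ * V₁)

theorem isShiftPair : IsShiftPair ϵ z (U₀ * V₀ - U₁ * V₁) (ϵ • (U₁ * V₀) - U₀ * V₁) where
  mul_left := by
    rw [mul_sub, sub_mul, hU.mul_zero_zero hV hϵ, hU.mul_one_one hV hϵ]
    module
  mul_right := by
    rw [mul_sub, sub_mul, mul_smul_comm, hU.mul_one_zero hV hϵ, hU.mul_zero_one hV hϵ,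
      smul_mul_assoc]
    module

theorem commute_add : Commute z (U₀ * V₀ + U₁ * V₁) := by
  rw [Commute, SemiconjBy, mul_add, add_mul, hU.mul_zero_zero hV hϵ, hU.mul_one_one hV hϵ]
  abel

theorem commute_add_smul : Commute z (U₀ * V₁ + ϵ • (U₁ * V₀)) := by
  rw [Commute, SemiconjBy, mul_add, add_mul, mul_smul_comm, hU.mul_zero_one hV hϵ,
    hU.mul_one_zero hV hϵ, smul_mul_assoc]
  module

omit hV in
theorem commute_mul (h : U₀ * U₀ = U₁ * U₁) : Commute z (U₀ * U₁) := by
  rw [Commute, SemiconjBy, hU.mul_zero_one hU hϵ, h, sub_self, smul_zero, add_zero]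

end IsExchangedBy

namespace IsDividedPowers

variable {e : ℕ → B} (he : IsDividedPowers ϵ ω e)

include he

variable [CharZero 𝕜]

theorem commute {t : B} (ht : Commute (e 1) t) (k : ℕ) : Commute (e k) t := by
  induction k using Nat.twoStepInduction with
  | zero => rw [he.zero]; exact Commute.one_left t
  | one => exact ht
  | more k ih ih' =>
    have hk : (k : 𝕜) + 2 ≠ 0 := by exact_mod_cast (k + 1).succ_ne_zero
    have solve : e (k + 2) = ((k : 𝕜) + 2)⁻¹ • (e 1 * e (k + 1) - (ϵ * (ω - k) / 4) • e k) := by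
      rw [he.one_mul_succ, add_sub_cancel_right, inv_smul_smul₀ hk]
    rw [solve]
    exact ((ht.mul_left ih').sub_left (ih.smul_left _)).smul_left _

theorem mul_succ_mul_one (P : B) (k : ℕ) : P * e (k + 1) * e 1 =
    ((k : 𝕜) + 2) • (P * e (k + 2)) + (ϵ * (ω - k) / 4) • (P * e k) := by
  rw [mul_assoc, (he.commute (Commute.refl _) (k + 1)).eq, he.one_mul_succ, mul_add,
    mul_smul_comm, mul_smul_comm]

variable {P P' : B} (hP : IsShiftPair ϵ (e 1) P P')

include hP

theorem succ_mul_mul_one (k : ℕ) : e (k + 1) * P * e 1 =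
    ((k : 𝕜) + 2) • (e (k + 2) * P) + (ϵ * (ω - k) / 4) • (e k * P) -
      (2 : 𝕜) • (e (k + 1) * P') := by
  have move_left : e 1 * e (k + 1) * P = e (k + 1) * P * e 1 + (2 : 𝕜) • (e (k + 1) * P') := by
    rw [← (he.commute (Commute.refl _) (k + 1)).eq, mul_assoc, hP.mul_left, mul_add,
      mul_smul_comm, mul_assoc]
  rw [eq_sub_iff_add_eq, ← move_left, he.one_mul_succ, add_mul, smul_mul_assoc, smul_mul_assoc]

theorem lie_mul_one (k : ℕ) : ⁅e (k + 1), P⁆ * e 1 + ⁅e (k + 1), P'⁆ =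
    ((k : 𝕜) + 2) • ⁅e (k + 2), P⁆ + (ϵ * (ω - k) / 4) • ⁅e k, P⁆ -
      (e (k + 1) * P' + P' * e (k + 1)) := by
  simp only [Ring.lie_def]
  rw [sub_mul, he.succ_mul_mul_one hP, he.mul_succ_mul_one]
  module

theorem anticommutator_mul_one (k : ℕ) :
    (e (k + 1) * P + P * e (k + 1)) * e 1 + (e (k + 1) * P' + P' * e (k + 1)) =
      ((k : 𝕜) + 2) • (e (k + 2) * P + P * e (k + 2)) +
        (ϵ * (ω - k) / 4) • (e k * P + P * e k) - ⁅e (k + 1), P'⁆ := by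
  rw [Ring.lie_def, add_mul, he.succ_mul_mul_one hP, he.mul_succ_mul_one]
  module

omit [CharZero 𝕜] hP in
theorem lie_zero (Q : B) : ⁅e 0, Q⁆ = 0 := by
  rw [he.zero, Ring.lie_def, one_mul, mul_one, sub_self]

omit he [CharZero 𝕜] in
theorem lie_one : ⁅e 1, P⁆ = (2 : 𝕜) • P' := by
  rw [Ring.lie_def, hP.mul_left, add_sub_cancel_left]

theorem anticommutator_one_eq_lie : e 1 * P' + P' * e 1 = ⁅e 2, P⁆ := by
  have h := he.lie_mul_one hP 0
  simp only [zero_add, he.lie_zero, lie_one hP, lie_one hP.swap, Nat.cast_zero,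
    smul_mul_assoc] at h
  refine smul_right_injective B (two_ne_zero (α := 𝕜)) ?_
  linear_combination (norm := module) h + hP.mul_right

theorem smul_anticommutator_succ_succ {k : ℕ}
    (ih : e (k + 1) * P' + P' * e (k + 1) = ⁅e (k + 2), P⁆ + (ϵ / 4) • ⁅e k, P⁆)
    (ih' : e (k + 1) * (ϵ • P) + (ϵ • P) * e (k + 1) = ⁅e (k + 2), P'⁆ + (ϵ / 4) • ⁅e k, P'⁆) :
    ((k : 𝕜) + 3) • (e (k + 2) * P' + P' * e (k + 2)) = ((k : 𝕜) + 3) • ⁅e (k + 3), P⁆ +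
      (ϵ * (ω - k + 3) / 4) • ⁅e (k + 1), P⁆ + (ϵ / 4) • (⁅e k, P⁆ * e 1 + ⁅e k, P'⁆ -
        (ω - k) • (e k * P' + P' * e k)) := by
  have h := he.anticommutator_mul_one hP.swap k
  have h' := he.lie_mul_one hP (k + 1)
  rw [ih, ih', add_mul, smul_mul_assoc, Ring.lie_def _ (ϵ • P), mul_smul_comm, smul_mul_assoc,
    ← smul_sub, ← Ring.lie_def] at h
  push_cast at h'
  linear_combination (norm := module) h' - h

/-- With `ϵ = 1` and `e 1 = y`, the `e k` are the coefficients of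
`(1 + t/2)^{ω/2+y} (1 - t/2)^{ω/2-y}`. Moving an eigenvector of `[y, ·]` with eigenvalue `2` past
this series multiplies it by `(1 + t/2)² / (1 - t/2)²`, which ties the anticommutators to the
commutators. -/
theorem anticommutator_eq_lie (k : ℕ) :
    e (k + 1) * P' + P' * e (k + 1) = ⁅e (k + 2), P⁆ + (ϵ / 4) • ⁅e k, P⁆ := by
  induction k using Nat.twoStepInduction generalizing P P' with
  | zero => rw [he.lie_zero, smul_zero, add_zero, he.anticommutator_one_eq_lie hP]
  | one =>
    have base {P P' : B} (hP : IsShiftPair ϵ (e 1) P P') :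
        e (0 + 1) * P' + P' * e (0 + 1) = ⁅e (0 + 2), P⁆ + (ϵ / 4) • ⁅e 0, P⁆ := by
      rw [he.lie_zero, smul_zero, add_zero, he.anticommutator_one_eq_lie hP]
    have h := he.smul_anticommutator_succ_succ hP (base hP) (base hP.swap)
    have lie_one : ⁅e (0 + 1), P⁆ = (2 : 𝕜) • P' := lie_one hP
    rw [he.lie_zero, he.lie_zero, zero_mul, he.zero, one_mul, mul_one, lie_one] at h
    rw [show ⁅e 1, P⁆ = (2 : 𝕜) • P' from lie_one]
    have three_ne_zero : ((0 : ℕ) : 𝕜) + 3 ≠ 0 := by norm_num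
    refine smul_right_injective B three_ne_zero ?_
    push_cast at h ⊢
    linear_combination (norm := module) h
  | more k ih ih' =>
    have h := he.smul_anticommutator_succ_succ hP (ih' hP) (ih' hP.swap)
    rw [he.lie_mul_one hP, ih hP] at h
    have succ_ne_zero : ((k + 1 : ℕ) : 𝕜) + 3 ≠ 0 := by exact_mod_cast (k + 3).succ_ne_zero
    refine smul_right_injective B succ_ne_zero ?_
    push_cast at h ⊢
    linear_combination (norm := module) h

theorem sum_functional_equation (hϵ : ϵ * ϵ = 1) {u : 𝕜} {c : ℕ → 𝕜}
    (hc : ∀ k : ℕ, (k + 2 + u - ω) * c (k + 2) = 4 * ϵ * (k - u) * c k) (K : ℕ) :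
    ∑ k ∈ Finset.range (K + 2),
      c k • (-u • (e k * P' + P' * e k) + ⁅e k, P'⁆ + ⁅e k, P⁆ * e 1) =
    ((K - u) * c K) • ⁅e (K + 1), P⁆ + ((K + 1 - u) * c (K + 1)) • ⁅e (K + 2), P⁆ := by
  have summand (k : ℕ) : -u • (e (k + 1) * P' + P' * e (k + 1)) + ⁅e (k + 1), P'⁆ +
      ⁅e (k + 1), P⁆ * e 1 =
        (k + 1 - u) • ⁅e (k + 2), P⁆ + (ϵ * (ω - k - 1 - u) / 4) • ⁅e k, P⁆ := by
    have h := he.lie_mul_one hP k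
    rw [he.anticommutator_eq_lie hP] at h ⊢
    linear_combination (norm := module) h
  induction K with
  | zero =>
    rw [Finset.sum_range_succ, Finset.sum_range_one, summand, he.lie_zero, he.lie_zero, he.zero,
      zero_mul, one_mul, mul_one, zero_add, lie_one hP, Nat.cast_zero]
    module
  | succ K ih =>
    rw [Finset.sum_range_succ, ih, summand]
    push_cast
    linear_combination (norm := module)
      ((-ϵ / 4) * hc K + ((u - K) * c K) * hϵ) • ⁅e (K + 1), P⁆

end IsDividedPowers

section RLL

variable [CharZero 𝕜] {X₀ X₁ D₀ D₁ z h : B}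

theorem exists_commute_mul_eq (hϵ : ϵ * ϵ = 1) (hX : IsExchangedBy ϵ z X₀ X₁)
    (hD : IsExchangedBy ϵ z D₀ D₁) (hXX : X₀ * X₀ = X₁ * X₁) (hDD : D₀ * D₀ = D₁ * D₁)
    (hDX : D₀ * X₁ = ϵ • (X₁ * D₀) + z) (hh : Commute h (X₀ * D₀)) (hz : Commute z h) :
    ∃ G, Commute z G ∧ (X₀ * D₀ - (1 / 2 : 𝕜) • h) * (X₁ * D₁ - (1 / 2 : 𝕜) • h) =
      G + (1 / 2 : 𝕜) • (X₀ * D₀ - X₁ * D₁) + (ϵ / 2) • ((ϵ • (X₁ * D₀) - X₀ * D₁) * z) := by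
  set Y := X₀ * D₀ + X₁ * D₁ with hY
  set Y' := X₀ * D₁ + ϵ • (X₁ * D₀) with hY'
  have commute_Y : Commute z Y := hX.commute_add hD hϵ
  have commute_Y' : Commute z Y' := hX.commute_add_smul hD hϵ
  refine ⟨ϵ • (X₀ * X₁ * (D₀ * D₁)) + (1 / 2 : 𝕜) • Y - (ϵ / 2) • (Y' * z) -
    (1 / 2 : 𝕜) • (h * Y) + (1 / 4 : 𝕜) • (h * h), ?_, ?_⟩
  · exact (((((((hX.commute_mul hϵ hXX).mul_right (hD.commute_mul hϵ hDD)).smul_right _).add_right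
      (commute_Y.smul_right _)).sub_right ((commute_Y'.mul_right (.refl z)).smul_right _)).sub_right
      ((hz.mul_right commute_Y).smul_right _)).add_right ((hz.mul_right hz).smul_right _))
  · have reorder : X₀ * D₀ * (X₁ * D₁) =
        ϵ • (X₀ * X₁ * (D₀ * D₁)) + X₀ * D₀ - ϵ • (X₀ * D₁ * z) := by
      rw [mul_assoc, ← mul_assoc D₀, hDX, add_mul, mul_add, hD.mul_one, mul_sub]
      simp only [mul_smul_comm, smul_mul_assoc, mul_assoc]
      module
    rw [hY, hY']
    simp only [mul_add, add_mul, mul_sub, sub_mul, mul_smul_comm, smul_mul_assoc]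
    rw [reorder, ← hh.eq]
    module

theorem rll_sub_eq {R A₀ A₁ G b w : B} {u v : 𝕜} (hA : A₀ - A₁ = b) (hS : Commute R (A₀ + A₁))
    (hG : Commute R G) (hAA : A₀ * A₁ = G + (1 / 2 : 𝕜) • b + (ϵ / 2) • w) :
    R * ((u + v) • 1 + A₀) * (v • 1 + A₁) - (v • 1 + A₀) * ((u + v) • 1 + A₁) * R =
      (1 / 2 : 𝕜) • (-u • (R * b + b * R) + ⁅R, b⁆ + ϵ • ⁅R, w⁆) := by
  have expand : R * ((u + v) • 1 + A₀) * (v • 1 + A₁) - (v • 1 + A₀) * ((u + v) • 1 + A₁) * R =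
      (v + u / 2) • (R * (A₀ + A₁) - (A₀ + A₁) * R) +
        (-u / 2) • (R * (A₀ - A₁) + (A₀ - A₁) * R) + (R * (A₀ * A₁) - A₀ * A₁ * R) := by
    simp only [mul_add, add_mul, mul_sub, sub_mul, mul_smul_comm, smul_mul_assoc, mul_one, one_mul,
      mul_assoc]
    module
  rw [expand, hS.eq, hA, hAA]
  simp only [Ring.lie_def, mul_add, add_mul, mul_smul_comm, smul_mul_assoc, hG.eq]
  module

theorem rll_sub_eq_remainder (hϵ : ϵ * ϵ = 1) {e : ℕ → B} (he : IsDividedPowers ϵ ω e)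
    (hX : IsExchangedBy ϵ (e 1) X₀ X₁) (hD : IsExchangedBy ϵ (e 1) D₀ D₁)
    (hXX : X₀ * X₀ = X₁ * X₁) (hDD : D₀ * D₀ = D₁ * D₁) (hDX : D₀ * X₁ = ϵ • (X₁ * D₀) + e 1)
    (hh : Commute h (X₀ * D₀)) (hz : Commute (e 1) h) {u : 𝕜} (v : 𝕜) {c : ℕ → 𝕜}
    (hc : ∀ k : ℕ, (k + 2 + u - ω) * c (k + 2) = 4 * ϵ * (k - u) * c k) {K : ℕ} {R d : B}
    (hR : R = ∑ k ∈ Finset.range (K + 2), c k • e k) (hd : d = ϵ • (X₁ * D₀) - X₀ * D₁) :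
    R * ((u + v) • 1 + (X₀ * D₀ - (1 / 2 : 𝕜) • h)) * (v • 1 + (X₁ * D₁ - (1 / 2 : 𝕜) • h)) -
      (v • 1 + (X₀ * D₀ - (1 / 2 : 𝕜) • h)) * ((u + v) • 1 + (X₁ * D₁ - (1 / 2 : 𝕜) • h)) * R =
    (ϵ / 2) • (((K - u) * c K) • ⁅e (K + 1), d⁆ + ((K + 1 - u) * c (K + 1)) • ⁅e (K + 2), d⁆) := by
  obtain ⟨G, hG, hAA⟩ := exists_commute_mul_eq hϵ hX hD hXX hDD hDX hh hz
  have commute_R {t : B} (ht : Commute (e 1) t) : Commute R t :=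
    hR ▸ Commute.sum_left _ _ _ fun k _ => (he.commute ht k).smul_left (c k)
  have commute_S : Commute R (X₀ * D₀ - (1 / 2 : 𝕜) • h + (X₁ * D₁ - (1 / 2 : 𝕜) • h)) := by
    rw [sub_add_sub_comm]
    exact commute_R ((hX.commute_add hD hϵ).sub_right
      ((hz.smul_right _).add_right (hz.smul_right _)))
  have lie_mul : ⁅R, d * e 1⁆ = ⁅R, d⁆ * e 1 := by
    rw [Ring.lie_def, Ring.lie_def, sub_mul, mul_assoc d, ← (commute_R (.refl (e 1))).eq,
      mul_assoc, mul_assoc]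
  have functional_equation :=
    he.sum_functional_equation (hd ▸ (hX.isShiftPair hD hϵ).swap) hϵ hc K
  rw [rll_sub_eq (sub_sub_sub_cancel_right _ _ _) commute_S (commute_R hG) hAA, ← hd, lie_mul,
    ← functional_equation]
  simp only [hR, Ring.lie_def, Finset.sum_mul, Finset.mul_sum, Finset.smul_sum,
    ← Finset.sum_add_distrib, ← Finset.sum_sub_distrib]
  refine Finset.sum_congr rfl fun k _ => ?_
  generalize X₀ * D₀ - X₁ * D₁ = b
  simp only [smul_mul_assoc, mul_smul_comm, sub_mul]
  linear_combination (norm := module)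
    (-(c k / 2) * hϵ) • (-u • (e k * b + b * e k) + (e k * b - b * e k))

end RLL

end FunctionalEquation

namespace SuperMetric

variable {ι : Type*} [Fintype ι] [DecidableEq ι] (S : SuperMetric ι)

/-! ### The graded Heisenberg algebra -/

theorem x_mul_x (a b : ι) : S.x a * S.x b = S.exch a b • (S.x b * S.x a) := by
  simpa [x] using RingQuot.mkAlgHom_rel ℂ (HeisRel.xx (S := S) a b)

theorem d_mul_d (a b : ι) : S.d a * S.d b = S.exch a b • (S.d b * S.d a) := by
  simpa [d] using RingQuot.mkAlgHom_rel ℂ (HeisRel.dd (S := S) a b)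

theorem d_mul_x (a b : ι) : S.d a * S.x b = S.g a b • 1 + S.exch a b • (S.x b * S.d a) := by
  simpa [x, d, sub_eq_iff_eq_add, Algebra.algebraMap_eq_smul_one] using
    RingQuot.mkAlgHom_rel ℂ (HeisRel.dx (S := S) a b)

/-- The Euler operator `ε^{ab} x_a ∂_b`. -/
def euler : S.Heis := ∑ a, ∑ b, S.g⁻¹ a b • (S.x a * S.d b)

theorem exch_mul_exch {a b : ι} (h : S.g⁻¹ a b ≠ 0) (c : ι) : S.exch a c * S.exch b c = 1 := by
  rw [exch, exch, S.deg_eq_of_ginv_ne_zero h, ← exch, exch_mul_self]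

theorem euler_mul_x (c : ι) : S.euler * S.x c = S.x c * S.euler + S.x c := by
  have contract : ∑ a, ∑ b, (S.g⁻¹ a b * S.g b c) • S.x a = S.x c := by
    simp [← Finset.sum_smul, sum_ginv_mul_g]
  conv_rhs => enter [2]; rw [← contract]
  simp only [euler, Finset.mul_sum, Finset.sum_mul, ← Finset.sum_add_distrib]
  refine Finset.sum_congr rfl fun a _ => Finset.sum_congr rfl fun b _ => ?_
  by_cases hg : S.g⁻¹ a b = 0
  · simp [hg]
  · rw [smul_mul_assoc, mul_assoc, d_mul_x, mul_add, mul_smul_comm, mul_smul_comm, ← mul_assoc,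
      x_mul_x, smul_mul_assoc, smul_smul, mul_comm (S.exch b c), S.exch_mul_exch hg, one_smul,
      mul_one, mul_smul_comm, mul_assoc]
    module

theorem d_mul_euler (c : ι) : S.d c * S.euler = S.euler * S.d c + S.d c := by
  have contract : ∑ b, ∑ a, (S.g c a * S.g⁻¹ a b) • S.d b = S.d c := by
    simp [← Finset.sum_smul, sum_g_mul_ginv]
  conv_rhs => enter [2]; rw [← contract, Finset.sum_comm]
  simp only [euler, Finset.mul_sum, Finset.sum_mul, ← Finset.sum_add_distrib]
  refine Finset.sum_congr rfl fun a _ => Finset.sum_congr rfl fun b _ => ?_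
  by_cases hg : S.g⁻¹ a b = 0
  · simp [hg]
  · rw [mul_smul_comm, ← mul_assoc, d_mul_x, add_mul, smul_mul_assoc, smul_mul_assoc, mul_assoc,
      d_mul_d, mul_smul_comm, smul_smul, S.exch_comm c, S.exch_comm c, S.exch_mul_exch hg,
      one_smul, one_mul, smul_mul_assoc, mul_assoc]
    module

theorem osc_mul_inHeis_x (j : Fin 2) (a b : ι) : S.osc j a * S.inHeis (S.x b) =
    sgn (S.deg a * S.deg b) • (S.inHeis (S.x b) * S.osc j a) := by
  rw [x, inHeis_mkAlgHom_ι]; exact S.osc_mul_heisGen j a (Sum.inl b)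

theorem osc_mul_inHeis_d (j : Fin 2) (a b : ι) : S.osc j a * S.inHeis (S.d b) =
    sgn (S.deg a * S.deg b) • (S.inHeis (S.d b) * S.osc j a) := by
  rw [d, inHeis_mkAlgHom_ι]; exact S.osc_mul_heisGen j a (Sum.inr b)

theorem commute_osc_inHeis_euler (j : Fin 2) (c : ι) :
    Commute (S.osc j c) (S.inHeis S.euler) := by
  simp only [euler, map_sum, map_smul, map_mul]
  refine Commute.sum_right _ _ _ fun a _ => Commute.sum_right _ _ _ fun b _ => ?_
  by_cases hg : S.g⁻¹ a b = 0
  · rw [hg, zero_smul]; exact Commute.zero_right _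
  · refine Commute.smul_right ?_ _
    rw [Commute, SemiconjBy, ← mul_assoc, osc_mul_inHeis_x, smul_mul_assoc, mul_assoc,
      osc_mul_inHeis_d, mul_smul_comm, S.deg_eq_of_ginv_ne_zero hg, smul_smul, sgn_mul_self,
      one_smul, mul_assoc]

/-! ### The invariant `ε_{ab} c_1^a c_2^b` and the pairs it exchanges -/

theorem isDividedPowers_divPow : IsDividedPowers S.eps S.omega S.divPow where
  zero := S.divPow_zero
  one_mul_succ := S.divPow_one_mul_divPow_succ

theorem isExchangedBy_osc (a : ι) : IsExchangedBy S.eps S.z (S.osc 0 a) (S.osc 1 a) where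
  mul_zero := by
    have h : S.osc 0 a * S.z = -S.eps • (S.z * S.osc 0 a) + S.osc 1 a :=
      S.mul_pair_zero fun _ _ => S.osc_mul_osc _ _ _ _
    rw [h]
    linear_combination (norm := module) (-S.eps_mul_self) • (S.z * S.osc 0 a)
  mul_one := by
    have h : S.osc 1 a * S.z = -S.eps • (S.z * S.osc 1 a) + S.eps • S.osc 0 a :=
      S.mul_pair_one fun _ _ => S.osc_mul_osc _ _ _ _
    rw [h]
    linear_combination (norm := module)
      (-S.eps_mul_self) • (S.z * S.osc 1 a) + S.eps_mul_self • S.osc 0 a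

theorem commute_z_heisGen (y : ι ⊕ ι) : Commute S.z (S.heisGen y) := by
  refine Commute.sum_left _ _ _ fun a _ => Commute.sum_left _ _ _ fun b _ => ?_
  by_cases hg : S.g a b = 0
  · rw [hg, zero_smul]; exact Commute.zero_left _
  · refine Commute.smul_left ?_ _
    rw [Commute, SemiconjBy, mul_assoc, osc_mul_heisGen, mul_smul_comm, ← mul_assoc,
      osc_mul_heisGen, smul_mul_assoc, S.deg_eq_of_g_ne_zero hg, smul_smul, sgn_mul_self,
      one_smul, mul_assoc]

theorem commute_z_inHeis (h : S.Heis) : Commute S.z (S.inHeis h) := by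
  have mem : S.inHeis h ∈ Algebra.adjoin ℂ (Set.range S.heisGen) := by
    rw [adjoin_range_heisGen]
    exact ⟨h, rfl⟩
  refine Algebra.adjoin_induction ?_ (fun r => ?_) (fun _ _ _ _ => .add_right)
    (fun _ _ _ _ => .mul_right) mem
  · rintro _ ⟨y, rfl⟩
    exact S.commute_z_heisGen y
  · exact (Algebra.commutes r S.z).symm

/-- The element `x_a c_j^a`. -/
def X (j : Fin 2) : S.Tensor := ∑ a, S.inHeis (S.x a) * S.osc j a

/-- The element `c_j^a ∂_a`. -/
def D (j : Fin 2) : S.Tensor := ∑ a, S.osc j a * S.inHeis (S.d a)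

theorem isExchangedBy_X : IsExchangedBy S.eps S.z (S.X 0) (S.X 1) :=
  .sum fun a => (S.isExchangedBy_osc a).mul_left (S.commute_z_inHeis _)

theorem isExchangedBy_D : IsExchangedBy S.eps S.z (S.D 0) (S.D 1) :=
  .sum fun a => (S.isExchangedBy_osc a).mul_right (S.commute_z_inHeis _)

end SuperMetric

theorem two_smul_sum_mul_self {κ A : Type*} [Fintype κ] [Ring A] [Algebra ℂ A] {p q : κ → A}
    {e r s : κ → κ → ℂ} (hp : ∀ a b, p b * p a = e a b • (p a * p b))
    (hq : ∀ a b, q a * q b + e a b • (q b * q a) = r a b • 1)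
    (hqp : ∀ a b, q a * p b = s a b • (p b * q a)) (hs : ∀ a b, s b a = s a b) :
    (2 : ℂ) • ((∑ a, p a * q a) * ∑ a, p a * q a) =
      ∑ a, ∑ b, (s a b * r a b) • (p a * p b) := by
  have square : (∑ a, p a * q a) * ∑ a, p a * q a =
      ∑ a, ∑ b, s a b • (p a * p b * (q a * q b)) := by
    rw [Finset.sum_mul_sum]
    refine Finset.sum_congr rfl fun a _ => Finset.sum_congr rfl fun b _ => ?_
    rw [mul_assoc, ← mul_assoc (q a), hqp, smul_mul_assoc, mul_smul_comm]
    simp only [mul_assoc]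
  have square' : (∑ a, p a * q a) * ∑ a, p a * q a =
      ∑ a, ∑ b, s a b • (p a * p b * (e a b • (q b * q a))) := by
    rw [square, Finset.sum_comm]
    refine Finset.sum_congr rfl fun a _ => Finset.sum_congr rfl fun b _ => ?_
    rw [hs, hp, smul_mul_assoc, mul_smul_comm]
  rw [two_smul]
  nth_rw 1 [square]
  rw [square', ← Finset.sum_add_distrib]
  refine Finset.sum_congr rfl fun a _ => ?_
  rw [← Finset.sum_add_distrib]
  refine Finset.sum_congr rfl fun b _ => ?_
  rw [← smul_add, ← mul_add, hq, mul_smul_comm, mul_one, smul_smul]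

namespace SuperMetric

variable {ι : Type*} [Fintype ι] [DecidableEq ι] (S : SuperMetric ι)

/-! ### The L-operators -/

theorem osc_mul_add_smul_osc_mul (j : Fin 2) (a b : ι) :
    S.osc j a * S.osc j b + S.exch a b • (S.osc j b * S.osc j a) = S.g⁻¹ a b • 1 := by
  have h := S.osc_mul_osc j j a b
  rw [oscContraction, oscSign, if_pos rfl, if_pos rfl] at h
  exact mul_add_smul_mul_eq_iff.mpr h

theorem two_smul_X_mul_X (j : Fin 2) : (2 : ℂ) • (S.X j * S.X j) =
    ∑ a, ∑ b, (sgn (S.deg a * S.deg b) * S.g⁻¹ a b) • (S.inHeis (S.x a) * S.inHeis (S.x b)) :=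
  two_smul_sum_mul_self
    (fun a b => by rw [← map_mul, x_mul_x, map_smul, map_mul, exch_comm])
    (S.osc_mul_add_smul_osc_mul j) (S.osc_mul_inHeis_x j)
    (fun a b => by rw [mul_comm (S.deg b)])

theorem D_eq (j : Fin 2) :
    S.D j = ∑ a, (sgn (S.deg a) • S.inHeis (S.d a)) * S.osc j a :=
  Finset.sum_congr rfl fun a _ => by
    rw [osc_mul_inHeis_d, zmod_two_mul_self, smul_mul_assoc]

theorem two_smul_D_mul_D (j : Fin 2) : (2 : ℂ) • (S.D j * S.D j) =
    ∑ a, ∑ b, (sgn (S.deg a * S.deg b) * S.g⁻¹ a b) •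
      ((sgn (S.deg a) • S.inHeis (S.d a)) * (sgn (S.deg b) • S.inHeis (S.d b))) := by
  rw [D_eq]
  refine two_smul_sum_mul_self (fun a b => ?_) (S.osc_mul_add_smul_osc_mul j) (fun a b => ?_)
    (fun a b => by rw [mul_comm (S.deg b)])
  · rw [smul_mul_smul_comm, ← map_mul, d_mul_d, map_smul, map_mul, exch_comm, smul_mul_smul_comm,
      smul_comm, mul_comm (sgn (S.deg b))]
  · rw [mul_smul_comm, osc_mul_inHeis_d, smul_mul_assoc, smul_comm]

theorem X_mul_X : S.X 0 * S.X 0 = S.X 1 * S.X 1 :=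
  smul_right_injective _ (two_ne_zero (α := ℂ))
    ((S.two_smul_X_mul_X 0).trans (S.two_smul_X_mul_X 1).symm)

theorem D_mul_D : S.D 0 * S.D 0 = S.D 1 * S.D 1 :=
  smul_right_injective _ (two_ne_zero (α := ℂ))
    ((S.two_smul_D_mul_D 0).trans (S.two_smul_D_mul_D 1).symm)

theorem D_mul_X : S.D 0 * S.X 1 = S.eps • (S.X 1 * S.D 0) + S.z := by
  have reorder (a b : ι) : S.osc 0 b * S.inHeis (S.x a * S.d b) * S.osc 1 a =
      sgn (S.deg b * S.deg a) •
        (S.inHeis (S.x a) * S.osc 1 a * (S.osc 0 b * S.inHeis (S.d b))) := by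
    have d_mul_osc : S.inHeis (S.d b) * S.osc 1 a =
        sgn (S.deg a * S.deg b) • (S.osc 1 a * S.inHeis (S.d b)) := by
      rw [osc_mul_inHeis_d, smul_smul, sgn_mul_self, one_smul]
    rw [map_mul, ← mul_assoc, osc_mul_inHeis_x, smul_mul_assoc, smul_mul_assoc, mul_assoc,
      d_mul_osc, mul_smul_comm, ← mul_assoc, mul_assoc _ (S.osc 0 b), osc_zero_mul_osc_one,
      mul_smul_comm, smul_mul_assoc, smul_smul, mul_comm (S.deg a), sgn_mul_self, one_smul]
    simp only [mul_assoc]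
  rw [D, X, z, pair, Finset.sum_mul_sum, Finset.sum_mul_sum, Finset.sum_comm (γ := ι),
    Finset.smul_sum, Finset.sum_comm (f := fun a b => S.g a b • _), ← Finset.sum_add_distrib]
  refine Finset.sum_congr rfl fun a _ => ?_
  rw [Finset.smul_sum, ← Finset.sum_add_distrib]
  refine Finset.sum_congr rfl fun b _ => ?_
  rw [mul_assoc, ← mul_assoc (S.inHeis _), ← map_mul, d_mul_x, map_add, map_smul, map_smul,
    map_one, ← mul_assoc, mul_add, add_mul, mul_smul_comm, mul_smul_comm, smul_mul_assoc,
    smul_mul_assoc, reorder, mul_one, smul_smul, exch, mul_assoc S.eps, sgn_mul_self, mul_one,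
    add_comm]

theorem euler_mul_X (j : Fin 2) : S.inHeis S.euler * S.X j = S.X j * S.inHeis S.euler + S.X j := by
  simp only [X, Finset.mul_sum, Finset.sum_mul, ← Finset.sum_add_distrib]
  refine Finset.sum_congr rfl fun a _ => ?_
  rw [← mul_assoc, ← map_mul, euler_mul_x, map_add, map_mul, add_mul, mul_assoc, mul_assoc,
    (S.commute_osc_inHeis_euler j a).eq]

theorem D_mul_euler (j : Fin 2) : S.D j * S.inHeis S.euler = S.inHeis S.euler * S.D j + S.D j := by
  simp only [D, Finset.mul_sum, Finset.sum_mul, ← Finset.sum_add_distrib]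
  refine Finset.sum_congr rfl fun a _ => ?_
  rw [mul_assoc, ← map_mul, d_mul_euler, map_add, map_mul, mul_add, ← mul_assoc,
    (S.commute_osc_inHeis_euler j a).eq, mul_assoc]

theorem commute_euler_X_mul_D (j : Fin 2) : Commute (S.inHeis S.euler) (S.X j * S.D j) := by
  rw [Commute, SemiconjBy, ← mul_assoc, euler_mul_X, mul_assoc, D_mul_euler, add_mul, mul_add,
    mul_assoc]

theorem inOsc_symProd_pair (j : Fin 2) (a b : ι) :
    S.inOsc j (S.symProd ![a, b]) = (S.cre j a * S.cre j b) 1 := by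
  simp [inOsc_symProd, Oscillators.creationProd]

theorem inOsc_symProd_pair_swap (j : Fin 2) (a b : ι) :
    S.inOsc j (S.symProd ![b, a]) = -S.exch a b • S.inOsc j (S.symProd ![a, b]) := by
  rw [inOsc_symProd_pair, inOsc_symProd_pair, cre_mul_cre, oscSign, if_pos rfl, exch_comm]
  rfl

theorem osc_mul_osc_eq_inOsc_symProd (j : Fin 2) (a b : ι) :
    S.osc j a * S.osc j b =
      S.inOsc j (S.symProd ![a, b]) + (1 / 2 * S.g⁻¹ a b) • 1 := by
  have cre_one : S.cre j b 1 = S.osc j b := by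
    have h := LinearMap.congr_fun (S.oscillators.leftMul_eq (j, b)) 1
    rw [LinearMap.add_apply, LinearMap.smul_apply, S.ann_one, smul_zero, add_zero] at h
    exact h.symm.trans (mul_one (S.osc j b))
  have ann_cre_one : (S.ann j a * S.cre j b) 1 = S.g⁻¹ a b • 1 := by
    rw [ann_mul_cre, oscContraction, if_pos rfl, LinearMap.add_apply, LinearMap.smul_apply,
      LinearMap.smul_apply, Module.End.mul_apply, ann_one, map_zero, smul_zero, add_zero]
    rfl
  have h := LinearMap.congr_fun (S.oscillators.leftMul_eq (j, a)) (S.cre j b 1)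
  rw [LinearMap.add_apply, LinearMap.smul_apply] at h
  rw [inOsc_symProd_pair, mul_smul, ← ann_cre_one, Module.End.mul_apply, Module.End.mul_apply]
  exact cre_one ▸ h

theorem X_mul_D (j : Fin 2) : S.X j * S.D j =
    ∑ a, ∑ b, (sgn (S.deg a) * sgn (S.deg a * S.deg b)) •
      (S.inOsc j (S.symProd ![a, b]) * S.inHeis (S.x a * S.d b)) +
    (1 / 2 : ℂ) • S.inHeis S.euler := by
  have euler_eq : S.inHeis S.euler = ∑ a, ∑ b, S.g⁻¹ a b • S.inHeis (S.x a * S.d b) := by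
    simp only [euler, map_sum, map_smul]
  have x_mul_osc (a b : ι) : S.inHeis (S.x a) * S.osc j b =
      sgn (S.deg a * S.deg b) • (S.osc j b * S.inHeis (S.x a)) := by
    rw [osc_mul_inHeis_x, mul_comm (S.deg b), smul_smul, sgn_mul_self, one_smul]
  rw [X, D, Finset.sum_mul_sum, euler_eq, Finset.smul_sum, ← Finset.sum_add_distrib]
  refine Finset.sum_congr rfl fun a _ => ?_
  rw [Finset.smul_sum, ← Finset.sum_add_distrib]
  refine Finset.sum_congr rfl fun b _ => ?_
  have reorder : S.inHeis (S.x a) * S.osc j a * (S.osc j b * S.inHeis (S.d b)) =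
      (sgn (S.deg a) * sgn (S.deg a * S.deg b)) •
        (S.osc j a * S.osc j b * S.inHeis (S.x a * S.d b)) := by
    rw [x_mul_osc, zmod_two_mul_self, smul_mul_assoc, mul_assoc, ← mul_assoc (S.inHeis _),
      x_mul_osc, smul_mul_assoc, mul_smul_comm, smul_smul, map_mul]
    simp only [mul_assoc]
  rw [reorder, osc_mul_osc_eq_inOsc_symProd, add_mul, smul_mul_assoc, one_mul, smul_add,
    smul_smul, smul_smul]
  by_cases hg : S.g⁻¹ a b = 0
  · simp only [hg, mul_zero]
  · rw [S.deg_eq_of_ginv_ne_zero hg, zmod_two_mul_self, sgn_mul_self, one_mul]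

theorem sum_F_mul_M (j : Fin 2) :
    ∑ a, ∑ b, S.inOsc j (S.F a b) * S.inHeis (S.M b a) =
      (-2 : ℂ) • ∑ a, ∑ b, (sgn (S.deg a) * sgn (S.deg a * S.deg b)) •
        (S.inOsc j (S.symProd ![a, b]) * S.inHeis (S.x a * S.d b)) := by
  have expand (a b : ι) : S.inOsc j (S.F a b) * S.inHeis (S.M b a) =
      (S.eps * sgn (S.deg b)) •
        (S.inOsc j (S.symProd ![a, b]) * S.inHeis (S.x b * S.d a)) +
      -(sgn (S.deg a) * sgn (S.deg a * S.deg b)) •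
        (S.inOsc j (S.symProd ![a, b]) * S.inHeis (S.x a * S.d b)) := by
    rw [F, M, map_smul, map_sub, map_smul, smul_mul_assoc, mul_sub, mul_smul_comm, exchM, sgn_add,
      sgn_add, mul_comm (S.deg b)]
    match_scalars
    · ring
    · linear_combination (-sgn (S.deg a) * sgn (S.deg a * S.deg b)) *
        (sgn (S.deg b) ^ 2 * S.eps_mul_self + sgn_mul_self (S.deg b))
  simp only [expand, Finset.sum_add_distrib]
  rw [Finset.sum_comm, ← Finset.sum_add_distrib, Finset.smul_sum]
  refine Finset.sum_congr rfl fun a _ => ?_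
  rw [← Finset.sum_add_distrib, Finset.smul_sum]
  refine Finset.sum_congr rfl fun b _ => ?_
  rw [inOsc_symProd_pair_swap, exch, smul_mul_assoc]
  match_scalars
  linear_combination (-sgn (S.deg a) * sgn (S.deg a * S.deg b)) * S.eps_mul_self

theorem L_eq (j : Fin 2) (u : ℂ) :
    S.L j u = u • 1 + (S.X j * S.D j - (1 / 2 : ℂ) • S.inHeis S.euler) := by
  rw [L, sum_F_mul_M, X_mul_D, add_sub_cancel_right]
  module

end SuperMetric

/-! ### The filtration by degree -/

/-- The elements of an algebra such that multiplication by them, on either side, lowers the degree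
in a filtration by a bounded amount. -/
def boundedMultipliers {A : Type*} [Ring A] [Algebra ℂ A] {F : ℕ → Submodule ℂ A}
    (hF : Antitone F) : Subalgebra ℂ A where
  carrier := {t | ∃ m, ∀ n, ∀ s ∈ F (n + m), t * s ∈ F n ∧ s * t ∈ F n}
  algebraMap_mem' r := ⟨0, fun n s hs => by
    rw [Algebra.algebraMap_eq_smul_one, smul_mul_assoc, mul_smul_comm, one_mul, mul_one]
    exact ⟨Submodule.smul_mem _ _ hs, Submodule.smul_mem _ _ hs⟩⟩
  add_mem' := by
    rintro t t' ⟨m, hm⟩ ⟨m', hm'⟩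
    refine ⟨m + m', fun n s hs => ?_⟩
    have h := hm n s (hF (by omega) hs)
    have h' := hm' n s (hF (by omega) hs)
    rw [add_mul, mul_add]
    exact ⟨add_mem h.1 h'.1, add_mem h.2 h'.2⟩
  mul_mem' := by
    rintro t t' ⟨m, hm⟩ ⟨m', hm'⟩
    refine ⟨m + m', fun n s hs => ⟨?_, ?_⟩⟩
    · rw [mul_assoc]
      exact (hm n _ (hm' (n + m) s (hF (by omega) hs)).1).1
    · rw [← mul_assoc]
      exact (hm' n _ (hm (n + m') s (hF (by omega) hs)).2).2

namespace Oscillators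

variable {κ B : Type*} [Ring B] [Algebra ℂ B] (O : Oscillators κ B)

theorem mul_creationProd {T : Module.End ℂ B} {f : κ → ℂ} {k : ℕ} {w : Fin k → κ}
    (hT : ∀ i, T * O.creation (w i) = f (w i) • (O.creation (w i) * T)) :
    T * O.creationProd w = (∏ i, f (w i)) • (O.creationProd w * T) := by
  induction k with
  | zero => simp [creationProd_zero]
  | succ k ih =>
    rw [creationProd_succ, ← mul_assoc, hT, smul_mul_assoc, mul_assoc,
      ih (w := Fin.tail w) fun i => hT i.succ, mul_smul_comm, smul_smul, Fin.prod_univ_succ,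
      mul_assoc]
    rfl

theorem creationProd_append {k l : ℕ} (w : Fin k → κ) (w' : Fin l → κ) :
    O.creationProd (Fin.append w w') = O.creationProd w * O.creationProd w' := by
  have h : (fun i => O.creation (Fin.append w w' i)) =
      Fin.append (fun i => O.creation (w i)) fun i => O.creation (w' i) := by
    funext i
    refine Fin.addCases (fun i => ?_) (fun i => ?_) i <;> simp
  rw [creationProd, h, List.ofFn_fin_append, List.prod_append, creationProd, creationProd]

theorem creationProd_cons (s : κ) {k : ℕ} (w : Fin k → κ) :
    O.creationProd (Fin.cons s w : Fin (k + 1) → κ) = O.creation s * O.creationProd w := by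
  rw [creationProd_succ, Fin.cons_zero, Fin.tail_cons]

theorem creation_mul_of_annihilation_left {s : κ} {b : B} (b' : B) (h : O.annihilation s b = 0) :
    O.creation s (b * b') = O.twist s b * O.creation s b' := by
  rw [annihilation_apply, sub_eq_zero] at h
  simp only [creation_apply, leftMul_apply, rightMul_apply, map_mul, mul_smul_comm, mul_add,
    ← mul_assoc, h]

theorem twist_mul_creation (s t : κ) : (O.twist s).toLinearMap * O.creation t =
    O.sign s t • (O.creation t * (O.twist s).toLinearMap) := by
  ext b
  simp only [Module.End.mul_apply, LinearMap.smul_apply, AlgHom.toLinearMap_apply, creation_apply,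
    leftMul_apply, rightMul_apply, map_smul, map_add, map_mul, twist_gen, O.twist_comm s t,
    smul_mul_assoc, mul_smul_comm]
  module

end Oscillators

namespace SuperMetric

variable {ι : Type*} [Fintype ι] [DecidableEq ι] (S : SuperMetric ι)

theorem highDegree_antitone : Antitone S.highDegree := by
  refine fun n m hnm => Submodule.span_mono ?_
  rintro t ⟨k, l, a, b, h, hkl, rfl⟩
  exact ⟨k, l, a, b, h, hnm.trans hkl, rfl⟩

theorem inOsc_symProd_mul_inOsc_symProd_mul_inHeis {k l : ℕ} (a : Fin k → ι) (b : Fin l → ι)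
    (h : S.Heis) : S.inOsc 0 (S.symProd a) * S.inOsc 1 (S.symProd b) * S.inHeis h =
      S.oscillators.creationProd (fun i => (0, a i))
        (S.oscillators.creationProd (fun i => (1, b i)) (S.inHeis h)) := by
  rw [mul_assoc, inOsc_symProd, inOsc_symProd,
    Oscillators.creationProd_one_mul _ fun _ => S.ann_inHeis _ _ _,
    Oscillators.creationProd_one_mul _ fun _ =>
      Oscillators.annihilation_creationProd_eq_zero _
        (fun _ => by simp [oscillators, oscContraction]) (S.ann_inHeis _ _ _)]

theorem cre_mem_highDegree (v : Fin 2 × ι) {n : ℕ} {t : S.Tensor} (ht : t ∈ S.highDegree n) :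
    S.oscillators.creation v t ∈ S.highDegree (n + 1) := by
  suffices S.highDegree n ≤ (S.highDegree (n + 1)).comap (S.oscillators.creation v) from this ht
  refine Submodule.span_le.mpr ?_
  rintro _ ⟨k, l, a, b, h, hkl, rfl⟩
  rw [inOsc_symProd_mul_inOsc_symProd_mul_inHeis]
  obtain ⟨j, c⟩ := v
  match j with
  | 0 =>
    refine Submodule.subset_span ⟨k + 1, l, Fin.cons c a, b, h, by omega, ?_⟩
    rw [inOsc_symProd_mul_inOsc_symProd_mul_inHeis, ← Module.End.mul_apply,
      ← Oscillators.creationProd_cons]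
    congr 2
    exact funext fun i => Fin.cases rfl (fun _ => rfl) i
  | 1 =>
    rw [SetLike.mem_coe, Submodule.mem_comap, ← Module.End.mul_apply,
      Oscillators.mul_creationProd _ fun i =>
        S.oscillators.creation_mul_creation (1, c) (0, a i), LinearMap.smul_apply]
    refine Submodule.smul_mem _ _
      (Submodule.subset_span ⟨k, l + 1, a, Fin.cons c b, h, by omega, ?_⟩)
    rw [inOsc_symProd_mul_inOsc_symProd_mul_inHeis, Module.End.mul_apply, ← Module.End.mul_apply
      (S.oscillators.creation _), ← Oscillators.creationProd_cons]
    congr 3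
    exact funext fun i => Fin.cases rfl (fun _ => rfl) i

theorem creationProd_inHeis_mem_highDegree {k : ℕ} (w : Fin k → Fin 2 × ι) (h : S.Heis) :
    S.oscillators.creationProd w (S.inHeis h) ∈ S.highDegree k := by
  induction k with
  | zero =>
    refine Submodule.subset_span ⟨0, 0, Fin.elim0, Fin.elim0, h, le_rfl, ?_⟩
    rw [inOsc_symProd_mul_inOsc_symProd_mul_inHeis]
    simp only [Oscillators.creationProd_zero, Module.End.one_apply]
  | succ k ih =>
    rw [Oscillators.creationProd_succ]
    exact S.cre_mem_highDegree _ (ih _)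

theorem map_highDegree_le {T : Module.End ℂ S.Tensor} {n m : ℕ}
    (hT : ∀ (k : ℕ) (w : Fin k → Fin 2 × ι) (h : S.Heis), n ≤ k →
      T (S.oscillators.creationProd w (S.inHeis h)) ∈ S.highDegree m) :
    (S.highDegree n).map T ≤ S.highDegree m := by
  refine Submodule.map_le_iff_le_comap.mpr (Submodule.span_le.mpr ?_)
  rintro _ ⟨k, l, a, b, h, hkl, rfl⟩
  rw [inOsc_symProd_mul_inOsc_symProd_mul_inHeis, ← Module.End.mul_apply,
    ← Oscillators.creationProd_append]
  exact hT _ _ _ hkl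

theorem map_highDegree_le_self {T : Module.End ℂ S.Tensor} {f : Fin 2 × ι → ℂ}
    (hT : ∀ v, T * S.oscillators.creation v = f v • (S.oscillators.creation v * T))
    (hT' : ∀ h, T (S.inHeis h) ∈ S.inHeis.range) (n : ℕ) :
    (S.highDegree n).map T ≤ S.highDegree n := by
  refine S.map_highDegree_le fun k w h hk => ?_
  obtain ⟨h', heq⟩ := hT' h
  rw [← Module.End.mul_apply, Oscillators.mul_creationProd _ fun i => hT (w i),
    LinearMap.smul_apply, Module.End.mul_apply, ← heq]
  exact Submodule.smul_mem _ _
    (S.highDegree_antitone hk (S.creationProd_inHeis_mem_highDegree w h'))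

theorem ann_creationProd_inHeis_mem_highDegree (v : Fin 2 × ι) {k : ℕ} (w : Fin k → Fin 2 × ι)
    (h : S.Heis) : S.oscillators.annihilation v (S.oscillators.creationProd w (S.inHeis h)) ∈
      S.highDegree (k - 1) := by
  induction k with
  | zero =>
    rw [Oscillators.creationProd_zero, Module.End.one_apply, ann_inHeis]
    exact zero_mem _
  | succ k ih =>
    rw [Oscillators.creationProd_succ, Module.End.mul_apply, ← Module.End.mul_apply,
      Oscillators.annihilation_mul_creation, LinearMap.add_apply]
    exact add_mem
      (Submodule.smul_mem _ _ (S.creationProd_inHeis_mem_highDegree _ h))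
      (Submodule.smul_mem _ _
        (S.highDegree_antitone (by omega) (S.cre_mem_highDegree _ (ih _))))

theorem ann_mem_highDegree (v : Fin 2 × ι) {n : ℕ} {t : S.Tensor}
    (ht : t ∈ S.highDegree (n + 1)) : S.oscillators.annihilation v t ∈ S.highDegree n :=
  S.map_highDegree_le (fun _ w h hk => S.highDegree_antitone (by omega)
    (S.ann_creationProd_inHeis_mem_highDegree v w h)) (Submodule.mem_map_of_mem ht)

theorem twist_mem_highDegree (v : Fin 2 × ι) {n : ℕ} {t : S.Tensor} (ht : t ∈ S.highDegree n) :
    S.twist v t ∈ S.highDegree n := by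
  have map_range : S.inHeis.range ≤ S.inHeis.range.comap (S.twist v) := by
    rw [← adjoin_range_heisGen]
    refine Algebra.adjoin_le ?_
    rintro _ ⟨y, rfl⟩
    refine Subalgebra.mem_comap _ _ _ |>.mpr ?_
    rw [heisGen, twist_tensorGen]
    exact Subalgebra.smul_mem _ (Algebra.subset_adjoin (Set.mem_range_self y)) _
  exact S.map_highDegree_le_self (S.oscillators.twist_mul_creation v)
    (fun h => map_range (S.inHeis.mem_range_self h)) n (Submodule.mem_map_of_mem ht)

theorem osc_mem_boundedMultipliers (j : Fin 2) (a : ι) :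
    S.osc j a ∈ boundedMultipliers S.highDegree_antitone := by
  refine ⟨1, fun n s hs => ⟨?_, ?_⟩⟩
  · have h : S.osc j a * s = S.cre j a s + (1 / 2 : ℂ) • S.ann j a s :=
      LinearMap.congr_fun (S.oscillators.leftMul_eq (j, a)) s
    rw [h]
    exact add_mem (S.highDegree_antitone (by omega) (S.cre_mem_highDegree _ hs))
      (Submodule.smul_mem _ _ (S.ann_mem_highDegree _ hs))
  · have twist_twist : S.twist (j, a) (S.twist (j, a) s) = s :=
      AlgHom.congr_fun (S.twist_comp_twist_eq_id (S.genSign_mul_self (j, a))) s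
    have h : s * S.osc j a =
        S.cre j a (S.twist (j, a) s) - (1 / 2 : ℂ) • S.ann j a (S.twist (j, a) s) := by
      conv_lhs => rw [← twist_twist]
      exact LinearMap.congr_fun (S.oscillators.rightMul_eq (j, a)) (S.twist (j, a) s)
    have hs' := S.twist_mem_highDegree (j, a) hs
    rw [h]
    exact sub_mem (S.highDegree_antitone (by omega) (S.cre_mem_highDegree _ hs'))
      (Submodule.smul_mem _ _ (S.ann_mem_highDegree _ hs'))

theorem heisGen_mem_boundedMultipliers (y : ι ⊕ ι) :
    S.heisGen y ∈ boundedMultipliers S.highDegree_antitone := by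
  refine ⟨0, fun n s hs => ⟨?_, ?_⟩⟩
  · refine S.map_highDegree_le_self (T := LinearMap.mulLeft ℂ (S.heisGen y))
      (f := fun v => sgn (S.deg v.2 * S.degH y)) (fun v => LinearMap.ext fun t => ?_)
      (fun h => ?_) n (Submodule.mem_map_of_mem hs)
    · have twist_heisGen : S.oscillators.twist v (S.heisGen y) =
          sgn (S.deg v.2 * S.degH y) • S.heisGen y := S.twist_tensorGen v (Sum.inr y)
      simp only [Module.End.mul_apply, LinearMap.smul_apply, LinearMap.mulLeft_apply,
        Oscillators.creation_mul_of_annihilation_left _ t (S.ann_heisGen v.1 v.2 y),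
        twist_heisGen, smul_mul_assoc, smul_smul, sgn_mul_self, one_smul]
    · rw [LinearMap.mulLeft_apply, ← inHeis_mkAlgHom_ι, ← map_mul]
      exact ⟨_, rfl⟩
  · refine S.map_highDegree_le_self (T := LinearMap.mulRight ℂ (S.heisGen y)) (f := 1)
      (fun v => LinearMap.ext fun t => ?_) (fun h => ?_) n (Submodule.mem_map_of_mem hs)
    · simp only [Pi.one_apply, one_smul, Module.End.mul_apply, LinearMap.mulRight_apply,
        Oscillators.creation_mul _ t (S.ann_heisGen v.1 v.2 y)]
    · rw [LinearMap.mulRight_apply, ← inHeis_mkAlgHom_ι, ← map_mul]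
      exact ⟨_, rfl⟩

theorem boundedMultipliers_highDegree : boundedMultipliers S.highDegree_antitone = ⊤ := by
  rw [eq_top_iff, ← adjoin_range_tensorGen]
  refine Algebra.adjoin_le ?_
  rintro _ ⟨⟨j, a⟩ | y, rfl⟩
  · exact S.osc_mem_boundedMultipliers j a
  · exact S.heisGen_mem_boundedMultipliers y

theorem exists_lie_mem_highDegree (t : S.Tensor) :
    ∃ m, ∀ n, ∀ s ∈ S.highDegree (n + m), ⁅s, t⁆ ∈ S.highDegree n := by
  obtain ⟨m, hm⟩ : t ∈ boundedMultipliers S.highDegree_antitone :=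
    S.boundedMultipliers_highDegree ▸ Algebra.mem_top
  exact ⟨m, fun n s hs => sub_mem (hm n s hs).2 (hm n s hs).1⟩

theorem divPow_mem_highDegree (k : ℕ) : S.divPow k ∈ S.highDegree (2 * k) := by
  refine Submodule.smul_mem _ _ ?_
  induction k with
  | zero =>
    have h := S.creationProd_inHeis_mem_highDegree Fin.elim0 1
    rwa [Oscillators.creationProd_zero, map_one] at h
  | succ k ih =>
    rw [pow_succ', Module.End.mul_apply]
    conv in S.pairCre => rw [pairCre, pair]
    simp only [LinearMap.sum_apply, LinearMap.smul_apply]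
    refine Submodule.sum_mem _ fun a _ => Submodule.sum_mem _ fun b _ =>
      Submodule.smul_mem _ _ ?_
    exact S.cre_mem_highDegree (0, a) (S.cre_mem_highDegree (1, b) ih)

end SuperMetric

theorem choose_two_add_two (k : ℕ) : (k + 2).choose 2 = k.choose 2 + 2 * k + 1 := by
  rw [Nat.choose_succ_succ, Nat.choose_one_right, Nat.choose_succ_succ, Nat.choose_one_right]
  ring

/-- The quotients of Gamma functions of which the coefficients of the R-operator are composed. -/
def gammaQuotient (α β : ℂ) (m : ℕ) : ℂ :=
  (-4) ^ m * (Complex.Gamma (m + α) / Complex.Gamma (m + β))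

theorem gammaQuotient_recurrence {α : ℂ} (β : ℂ) {m : ℕ} (hα : m + α ≠ 0) :
    (m + β) * gammaQuotient α β (m + 1) = -4 * (m + α) * gammaQuotient α β m := by
  have shift (γ : ℂ) : ((m + 1 : ℕ) : ℂ) + γ = m + γ + 1 := by push_cast; ring
  rw [gammaQuotient, gammaQuotient, shift, shift, Complex.Gamma_add_one _ hα, div_eq_mul_inv,
    div_eq_mul_inv, Complex.one_div_Gamma_eq_self_mul_one_div_Gamma_add_one (m + β)]
  ring

namespace SuperMetric

variable {ι : Type*} [Fintype ι] [DecidableEq ι] (S : SuperMetric ι)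

/-! ### The R-operator -/

theorem RPartial_eq_sum_divPow (r : ℕ → ℂ) (K : ℕ) : S.RPartial r K =
    ∑ k ∈ Finset.range K, ((-S.eps) ^ k.choose 2 * r k) • S.divPow k := by
  refine Finset.sum_congr rfl fun k _ => ?_
  have hk : (k.factorial : ℂ) ≠ 0 := by exact_mod_cast k.factorial_ne_zero
  rw [invariant_eq_smul_divPow, smul_smul]
  congr 1
  field_simp

theorem signed_recurrence {r : ℕ → ℂ} {u : ℂ}
    (hr : ∀ k : ℕ, (k + 2 + u - S.omega) * r (k + 2) = 4 * (u - k) * r k) (k : ℕ) :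
    (k + 2 + u - S.omega) * ((-S.eps) ^ (k + 2).choose 2 * r (k + 2)) =
      4 * S.eps * (k - u) * ((-S.eps) ^ k.choose 2 * r k) := by
  have even_power : (-S.eps) ^ (2 * k) = 1 := by
    rw [pow_mul, neg_sq, sq, S.eps_mul_self, one_pow]
  rw [choose_two_add_two, pow_succ, pow_add, even_power]
  linear_combination (-S.eps * (-S.eps) ^ k.choose 2) * hr k

theorem rll_of_recurrence {r : ℕ → ℂ} {u : ℂ} (v : ℂ)
    (hr : ∀ k : ℕ, (k + 2 + u - S.omega) * r (k + 2) = 4 * (u - k) * r k) : S.RLL r u v := by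
  intro n
  obtain ⟨m, hm⟩ := S.exists_lie_mem_highDegree (S.eps • (S.X 1 * S.D 0) - S.X 0 * S.D 1)
  have tail_mem (k : ℕ) (hk : n + m ≤ k) := hm n _
    (S.highDegree_antitone (by omega : n + m ≤ 2 * k) (S.divPow_mem_highDegree k))
  refine ⟨n + m + 2, fun K hK => ?_⟩
  obtain ⟨K, rfl⟩ : ∃ K', K = K' + 2 := ⟨K - 2, by omega⟩
  have divPow_one := S.divPow_one
  rw [L_eq, L_eq, L_eq, L_eq, rll_sub_eq_remainder S.eps_mul_self S.isDividedPowers_divPow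
    (divPow_one ▸ S.isExchangedBy_X) (divPow_one ▸ S.isExchangedBy_D) S.X_mul_X S.D_mul_D
    (divPow_one ▸ S.D_mul_X) (S.commute_euler_X_mul_D 0) (divPow_one ▸ S.commute_z_inHeis _) v
    (S.signed_recurrence hr) (S.RPartial_eq_sum_divPow r _) rfl]
  exact Submodule.smul_mem _ _ (add_mem
    (Submodule.smul_mem _ _ (tail_mem (K + 1) (by omega)))
    (Submodule.smul_mem _ _ (tail_mem (K + 2) (by omega))))

theorem gammaCoeff_two_mul (A B u : ℂ) (m : ℕ) : S.gammaCoeff A B u (2 * m) =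
    gammaQuotient (-(u / 2)) (1 + (u - S.omega) / 2) m * A := by
  rw [gammaCoeff, if_pos (even_two_mul m), Nat.mul_div_cancel_left m two_pos, gammaQuotient,
    sub_eq_add_neg, add_assoc]

theorem gammaCoeff_two_mul_add_one (A B u : ℂ) (m : ℕ) : S.gammaCoeff A B u (2 * m + 1) =
    gammaQuotient (-((u - 1) / 2)) (1 + (u - S.omega + 1) / 2) m * B := by
  rw [gammaCoeff, if_neg (Nat.not_even_two_mul_add_one m),
    show (2 * m + 1) / 2 = m by omega, gammaQuotient, sub_eq_add_neg (m : ℂ), add_assoc]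

theorem gammaCoeff_recurrence (A B : ℂ) {u : ℂ} (hu : ∀ n : ℕ, u ≠ n) (k : ℕ) :
    (k + 2 + u - S.omega) * S.gammaCoeff A B u (k + 2) = 4 * (u - k) * S.gammaCoeff A B u k := by
  rcases k.even_or_odd' with ⟨m, rfl | rfl⟩
  · have hα : (m : ℂ) + -(u / 2) ≠ 0 := fun h => hu (2 * m) (by
      push_cast
      linear_combination (-2 : ℂ) * h)
    rw [show 2 * m + 2 = 2 * (m + 1) by ring, gammaCoeff_two_mul, gammaCoeff_two_mul]
    push_cast
    linear_combination (2 * A) * gammaQuotient_recurrence (1 + (u - S.omega) / 2) hα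
  · have hα : (m : ℂ) + -((u - 1) / 2) ≠ 0 := fun h => hu (2 * m + 1) (by
      push_cast
      linear_combination (-2 : ℂ) * h)
    rw [show 2 * m + 1 + 2 = 2 * (m + 1) + 1 by ring, gammaCoeff_two_mul_add_one,
      gammaCoeff_two_mul_add_one]
    push_cast
    linear_combination (2 * B) * gammaQuotient_recurrence (1 + (u - S.omega + 1) / 2) hα

/-! ### The Jordan-Schwinger generators -/

theorem exchM_comm (a b : ι) : S.exchM a b = S.exchM b a := by
  rw [exchM, exchM, mul_comm (S.deg a), add_right_comm]

theorem exchM_mul_self (a b : ι) : S.exchM a b * S.exchM a b = 1 := by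
  rw [exchM, mul_mul_mul_comm, eps_mul_self, sgn_mul_self, one_mul]

theorem neg_exchM_mul_neg_exchM (a b : ι) : -S.exchM a b * -S.exchM b a = 1 := by
  rw [neg_mul_neg, S.exchM_comm b, exchM_mul_self]

theorem superAnti_x_mul_d (b c e a : ι) :
    superAnti (S.deg b + S.deg c) (S.deg e + S.deg a) (S.x b * S.d c) (S.x e * S.d a) =
      (2 * S.exch c e) • (S.x b * S.x e * (S.d c * S.d a)) + S.g c e • (S.x b * S.d a) +
        (sgn ((S.deg b + S.deg c) * (S.deg e + S.deg a)) * S.g a b) • (S.x e * S.d c) := by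
  have normal_order (b c e a : ι) : S.x b * S.d c * (S.x e * S.d a) =
      S.g c e • (S.x b * S.d a) + S.exch c e • (S.x b * S.x e * (S.d c * S.d a)) := by
    rw [mul_assoc, ← mul_assoc (S.d c), d_mul_x]
    simp only [add_mul, mul_add, smul_mul_assoc, mul_smul_comm, one_mul, mul_assoc]
  have sign_eq : sgn ((S.deg b + S.deg c) * (S.deg e + S.deg a)) *
      (S.exch a b * S.exch e b * S.exch a c) = S.exch c e := by
    simp only [exch, sgn_add, mul_add, add_mul, mul_comm]
    grind [S.eps_mul_self, sgn_mul_self]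
  rw [superAnti, normal_order, normal_order, S.x_mul_x e b, S.d_mul_d a c]
  simp only [smul_mul_assoc, mul_smul_comm, smul_smul, smul_add]
  linear_combination (norm := module) sign_eq • (S.x b * S.x e * (S.d c * S.d a))

/-- The part of `{x_{t_0} ∂_{t_1}, M_{t_2 a}}` that is odd under the exchange of `t_0` and `t_2`. -/
def outerPart (a : ι) (t : Fin 3 → ι) : S.Heis :=
  (2 * S.exch (t 1) (t 2)) • (S.x (t 0) * S.x (t 2) * (S.d (t 1) * S.d a)) -
    (S.exchM (t 2) a * sgn ((S.deg (t 0) + S.deg (t 1)) * (S.deg (t 2) + S.deg a)) *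
      S.g (t 2) (t 0)) • (S.x a * S.d (t 1))

/-- The part of `{x_{t_0} ∂_{t_1}, M_{t_2 a}}` that is odd under the exchange of `t_1` and `t_2`. -/
def innerPart (a : ι) (t : Fin 3 → ι) : S.Heis :=
  S.g (t 1) (t 2) • (S.x (t 0) * S.d a) -
    (2 * S.exchM (t 2) a * S.exch (t 1) a) • (S.x (t 0) * S.x a * (S.d (t 1) * S.d (t 2)))

/-- The contraction of `∂_a` with `x_{t_0}` in `{x_{t_0} ∂_{t_1}, x_{t_2} ∂_a}`. -/
def leftContraction (a : ι) (t : Fin 3 → ι) : S.Heis :=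
  (sgn ((S.deg (t 0) + S.deg (t 1)) * (S.deg (t 2) + S.deg a)) * S.g a (t 0)) •
    (S.x (t 2) * S.d (t 1))

/-- The contraction of `∂_{t_1}` with `x_a` in `{x_{t_0} ∂_{t_1}, x_a ∂_{t_2}}`, with its sign
in `M_{t_2 a}`. -/
def rightContraction (a : ι) (t : Fin 3 → ι) : S.Heis :=
  (-S.exchM (t 2) a * S.g (t 1) a) • (S.x (t 0) * S.d (t 2))

theorem superAnti_x_mul_d_M (a : ι) (t : Fin 3 → ι) :
    superAnti (S.deg (t 0) + S.deg (t 1)) (S.deg (t 2) + S.deg a) (S.x (t 0) * S.d (t 1))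
        (S.M (t 2) a) =
      S.outerPart a t + S.innerPart a t + (S.leftContraction a t + S.rightContraction a t) := by
  have linear : superAnti (S.deg (t 0) + S.deg (t 1)) (S.deg (t 2) + S.deg a)
      (S.x (t 0) * S.d (t 1)) (S.M (t 2) a) =
      superAnti (S.deg (t 0) + S.deg (t 1)) (S.deg (t 2) + S.deg a)
        (S.x (t 0) * S.d (t 1)) (S.x (t 2) * S.d a) -
      S.exchM (t 2) a • superAnti (S.deg (t 0) + S.deg (t 1)) (S.deg a + S.deg (t 2))
        (S.x (t 0) * S.d (t 1)) (S.x a * S.d (t 2)) := by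
    simp only [superAnti, M, mul_sub, sub_mul, mul_smul_comm, smul_mul_assoc,
      add_comm (S.deg a)]
    module
  rw [linear, superAnti_x_mul_d, superAnti_x_mul_d, add_comm (S.deg a)]
  simp only [outerPart, innerPart, leftContraction, rightContraction]
  module

theorem superSym_outerPart (a : ι) (t : Fin 3 → ι) :
    superSym (fun s t => -S.exchM s t) (S.outerPart a) t = 0 := by
  refine superSym_eq_zero_of_forall_perm S.neg_exchM_mul_neg_exchM (Equiv.swap 0 2)
    (fun t => ?_) t
  have sign_eq : S.exchM (t 2) (t 1) * S.exchM (t 2) (t 0) * S.exchM (t 1) (t 0) *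
      (S.exch (t 1) (t 0) * S.exch (t 2) (t 0)) = S.exch (t 1) (t 2) := by
    simp only [exch, exchM, sgn_add, mul_comm]
    grind [S.eps_mul_self, sgn_mul_self]
  have contraction_eq : S.exchM (t 2) (t 1) * S.exchM (t 2) (t 0) * S.exchM (t 1) (t 0) *
      (S.exchM (t 0) a * sgn ((S.deg (t 2) + S.deg (t 1)) * (S.deg (t 0) + S.deg a)) *
        S.g (t 0) (t 2)) =
      S.exchM (t 2) a * sgn ((S.deg (t 0) + S.deg (t 1)) * (S.deg (t 2) + S.deg a)) *
        S.g (t 2) (t 0) := by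
    by_cases h : S.g (t 0) (t 2) = 0
    · simp [S.g_swap (t 0) (t 2), h]
    rw [S.g_swap (t 0) (t 2)]
    simp only [exchM, ← S.deg_eq_of_g_ne_zero h, sgn_add, zmod_two_mul_self, mul_comm]
    grind [S.eps_mul_self, sgn_mul_self]
  rw [wordSign_swap_zero_two]
  simp only [outerPart, Function.comp_apply, Equiv.swap_apply_left, Equiv.swap_apply_right,
    show Equiv.swap (0 : Fin 3) 2 1 = 1 from rfl, S.x_mul_x (t 2) (t 0), smul_mul_assoc]
  linear_combination (norm := module)
    (-2 * sign_eq) • (S.x (t 0) * S.x (t 2) * (S.d (t 1) * S.d a)) +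
      contraction_eq • (S.x a * S.d (t 1))

theorem superSym_innerPart (a : ι) (t : Fin 3 → ι) :
    superSym (fun s t => -S.exchM s t) (S.innerPart a) t = 0 := by
  refine superSym_eq_zero_of_forall_perm S.neg_exchM_mul_neg_exchM
    (Equiv.swap 1 2) (fun t => ?_) t
  have sign_eq : S.exchM (t 2) (t 1) * S.exchM (t 1) a * S.exch (t 2) a * S.exch (t 2) (t 1) =
      S.exchM (t 2) a * S.exch (t 1) a := by
    simp only [exch, exchM, sgn_add, mul_comm]
    grind [S.eps_mul_self, sgn_mul_self]
  have contraction_eq : S.exchM (t 2) (t 1) * S.g (t 2) (t 1) = S.g (t 1) (t 2) := by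
    by_cases h : S.g (t 1) (t 2) = 0
    · simp [S.g_swap (t 1) (t 2), h]
    rw [S.g_swap (t 1) (t 2)]
    simp only [exchM, ← S.deg_eq_of_g_ne_zero h, sgn_add, zmod_two_mul_self]
    grind [S.eps_mul_self, sgn_mul_self]
  rw [wordSign_swap_one_two]
  simp only [innerPart, Function.comp_apply, Equiv.swap_apply_left, Equiv.swap_apply_right,
    show Equiv.swap (1 : Fin 3) 2 0 = 0 from rfl, S.d_mul_d (t 2) (t 1), mul_smul_comm]
  linear_combination (norm := module)
    (2 * sign_eq) • (S.x (t 0) * S.x a * (S.d (t 1) * S.d (t 2))) -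
      contraction_eq • (S.x (t 0) * S.d a)

theorem superSym_leftContraction (a : ι) (t : Fin 3 → ι) :
    superSym (fun s t => -S.exchM s t) (S.leftContraction a) t =
      -superSym (fun s t => -S.exchM s t) (S.rightContraction a) t := by
  refine superSym_eq_neg_of_forall_perm S.neg_exchM_mul_neg_exchM (finRotate 3) (fun t => ?_) t
  have contraction_eq : S.exchM (t 1) (t 0) * S.exchM (t 2) (t 0) *
      (sgn ((S.deg (t 1) + S.deg (t 2)) * (S.deg (t 0) + S.deg a)) * S.g a (t 1)) =
      S.exchM (t 2) a * S.g (t 1) a := by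
    by_cases h : S.g a (t 1) = 0
    · simp [S.g_swap a (t 1), h]
    rw [S.g_swap a (t 1)]
    simp only [exchM, ← S.deg_eq_of_g_ne_zero h, sgn_add, mul_add, add_mul, zmod_two_mul_self,
      mul_comm]
    grind [S.eps_mul_self, sgn_mul_self]
  have neg_right : -S.rightContraction a t =
      (S.exchM (t 2) a * S.g (t 1) a) • (S.x (t 0) * S.d (t 2)) := by
    rw [rightContraction]; module
  rw [wordSign_finRotate, Fin.prod_univ_two, neg_mul_neg, neg_right, ← contraction_eq]
  exact smul_smul (S.exchM (t 1) (t 0) * S.exchM (t 2) (t 0)) _ _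

theorem symAntiM_eq_superSym (b c d a : ι) :
    S.symAntiM b c d a = (2 : ℂ) • superSym (fun s t => -S.exchM s t) (fun t : Fin 3 → ι =>
      superAnti (S.deg (t 0) + S.deg (t 1)) (S.deg (t 2) + S.deg a)
        (S.x (t 0) * S.d (t 1)) (S.M (t 2) a)) ![b, c, d] := by
  have split (t : Fin 3 → ι) : superAnti (S.deg (t 0) + S.deg (t 1)) (S.deg (t 2) + S.deg a)
      (S.M (t 0) (t 1)) (S.M (t 2) a) =
      superAnti (S.deg (t 0) + S.deg (t 1)) (S.deg (t 2) + S.deg a)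
        (S.x (t 0) * S.d (t 1)) (S.M (t 2) a) +
      -S.exchM (t 1) (t 0) • superAnti (S.deg (t 1) + S.deg (t 0)) (S.deg (t 2) + S.deg a)
        (S.x (t 1) * S.d (t 0)) (S.M (t 2) a) := by
    rw [M, S.exchM_comm (t 1), add_comm (S.deg (t 1))]
    simp only [superAnti, mul_sub, sub_mul, mul_smul_comm, smul_mul_assoc]
    module
  have swap := superSym_wordSign_smul_comp S.neg_exchM_mul_neg_exchM
    (Equiv.swap 0 1) (fun t : Fin 3 → ι =>
      superAnti (S.deg (t 0) + S.deg (t 1)) (S.deg (t 2) + S.deg a)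
        (S.x (t 0) * S.d (t 1)) (S.M (t 2) a)) ![b, c, d]
  simp_rw [wordSign_swap_zero_one] at swap
  simp_rw [symAntiM, split, superSym_add, two_smul]
  exact congrArg _ swap

theorem symAntiM_eq_zero (b c d a : ι) : S.symAntiM b c d a = 0 := by
  simp_rw [symAntiM_eq_superSym, superAnti_x_mul_d_M, superSym_add, superSym_outerPart,
    superSym_innerPart, superSym_leftContraction]
  module

end SuperMetric

end

theorem mainTheorem8 {ι : Type*} [Fintype ι] [DecidableEq ι] (S : SuperMetric ι) :
    -- the super-anticommutator condition on the Jordan-Schwinger generators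
    (∀ b c d a : ι, S.symAntiM b c d a = 0) ∧
    -- the RLL-relation with the R-operator given by Gamma functions
    (∀ (A B : ℂ → ℂ) (u v : ℂ), (∀ n : ℕ, u ≠ n) →
      S.RLL (S.gammaCoeff (A u) (B u) u) u v) ∧
    -- the RLL-relation for every solution of the recurrence, at arbitrary `u`
    (∀ (r : ℕ → ℂ) (u v : ℂ),
      (∀ k : ℕ, (k + 2 + u - S.omega) * r (k + 2) = 4 * (u - k) * r k) →
      S.RLL r u v) :=
  ⟨S.symAntiM_eq_zero,
    fun A B _ v hu => S.rll_of_recurrence v (S.gammaCoeff_recurrence (A _) (B _) hu),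
    fun _ _ v hr => S.rll_of_recurrence v hr⟩
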